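/- Let $H$ be the Hopf $*$-algebra of representative functions on a compact quantum group, i.e. a complex Hopf algebra $(H,\Delta,\varepsilon,S)$ with an involution for which $\Delta$ and $\varepsilon$ are $*$-preserving, and which is linearly spanned by the coefficients $u_{ij}$ of its finite dimensional unitary corepresentations $u$ (matrices $u$ over $H$ with $\Delta(u_{ij})=\sum_k u_{ik}\otimes u_{kj}$, $\varepsilon(u_{ij})=\delta_{ij}$, $uu^*=u^*u=1$). For $z\in\mathbb{C}$ let $f_z:H\to\mathbb{C}$ be Woronowicz's functional, i.e. the linear functional such that $(f_z(u_{ij}))_{ij}=F_u^z$ for every irreducible unitary corepresentation $u$, where $F_u$ is the unique positive definite complex matrix with $F_u\,u=(S^2(u_{ij}))_{ij}\,F_u$ and $\mathrm{Tr}(F_u)=\mathrm{Tr}(F_u^{-1})$. Let $A\neq 0$ be a finite dimensional C*-algebra, written as a direct sum of (nonzero) complex matrix algebras; the components of $Q\in A$ are called the matrix blocks of $Q$, and $\mathrm{Tr}$ is the trace of $A$ which on each matrix algebra is the usual (unnormalised) trace. A coaction of $H$ on $A$ is a unital morphism of $*$-algebras $v:A\to A\otimes H$ with $(v\otimes id)v=(id\otimes\Delta)v$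 and $(id\otimes\varepsilon)v=id$. **Lemma 4.1.** For any coaction $v:A\to A\otimes H$ there is a unique $Q\in A$ such that (i) $\mathrm{ad}(Q)=(id\otimes f_{1/4})v$, where $\mathrm{ad}(Q)(a)=QaQ^{-1}$; (ii) $Q>0$ (that is, $Q$ is positive and invertible); (iii) $\mathrm{Tr}(Q^4)=1$; (iv) the numbers $\mathrm{Tr}(B^{-4})$, with $B$ running over the matrix blocks of $Q$, are all equal. Consequently, for this $Q$, the linear form $\varphi=\mathrm{Tr}(Q^4\,\cdot)$ is a $\delta$-form for some $\delta>0$, meaning that $\varphi(1)=1$ and $\mathrm{Tr}(B^{-4})=\delta^2$ for every matrix block $B$ of the unique $Q'>0$ such that $\varphi=\mathrm{Tr}(Q'^4\,\cdot)$. -/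

import Mathlib

open scoped TensorProduct Matrix ComplexOrder

noncomputable section

namespace QuantumCoaction

section HopfStar

variable {H : Type*} [Ring H] [StarRing H] [HopfAlgebra ℂ H]

/-- A finite dimensional unitary corepresentation of `H`, as a matrix `u` over `H`:
`Δ(u_ij) = ∑ₖ u_ik ⊗ u_kj`, `ε(u_ij) = δ_ij`, and `u` is unitary. -/
structure IsUnitaryCorep {n : ℕ} (u : Matrix (Fin n) (Fin n) H) : Prop where
  comul_apply : ∀ i j, Coalgebra.comul (R := ℂ) (u i j) = ∑ k, u i k ⊗ₜ[ℂ] u k j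
  counit_apply : ∀ i j, Coalgebra.counit (R := ℂ) (u i j) = if i = j then 1 else 0
  conjTranspose_mul_self : uᴴ * u = 1
  mul_conjTranspose_self : u * uᴴ = 1

/-- A scalar matrix, seen as a matrix over `H`. -/
def scalarMatrix (H : Type*) [Ring H] [HopfAlgebra ℂ H] {n : ℕ}
    (T : Matrix (Fin n) (Fin n) ℂ) : Matrix (Fin n) (Fin n) H :=
  T.map (algebraMap ℂ H)

/-- An irreducible unitary corepresentation: the only self-intertwiners are the scalars. -/
structure IsIrredUnitaryCorep {n : ℕ} (u : Matrix (Fin n) (Fin n) H) : Prop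
    extends IsUnitaryCorep u where
  irreducible : ∀ T : Matrix (Fin n) (Fin n) ℂ,
    scalarMatrix H T * u = u * scalarMatrix H T → ∃ c : ℂ, T = c • (1 : Matrix (Fin n) (Fin n) ℂ)

/-- The Hopf `*`-algebra of representative functions on a compact quantum group (also called a
CQG algebra): a complex Hopf algebra with an involution for which `Δ` and `ε` are `*`-preserving,
linearly spanned by the coefficients of its finite dimensional unitary corepresentations. -/
class IsCQGAlgebra (H : Type*) [Ring H] [StarRing H] [HopfAlgebra ℂ H] [StarModule ℂ H] :
    Prop where
  comul_star : ∀ a : H, Coalgebra.comul (R := ℂ) (star a) = star (Coalgebra.comul (R := ℂ) a)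
  counit_star : ∀ a : H, Coalgebra.counit (R := ℂ) (star a) = star (Coalgebra.counit (R := ℂ) a)
  span_coeff : Submodule.span ℂ {a : H | ∃ (n : ℕ) (u : Matrix (Fin n) (Fin n) H) (i j : Fin n),
    IsUnitaryCorep u ∧ a = u i j} = ⊤

/-- The complex power `F ^ z` of a positive definite matrix, by functional calculus:
`F ^ z = U diag(λ ^ z) U*` when `F = U diag(λ) U*`. -/
def posDefCpow {n : ℕ} {F : Matrix (Fin n) (Fin n) ℂ} (hF : F.PosDef) (z : ℂ) :
    Matrix (Fin n) (Fin n) ℂ :=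
  (hF.isHermitian.eigenvectorUnitary : Matrix (Fin n) (Fin n) ℂ) *
    Matrix.diagonal (fun i => ((hF.isHermitian.eigenvalues i : ℝ) : ℂ) ^ z) *
    (hF.isHermitian.eigenvectorUnitary : Matrix (Fin n) (Fin n) ℂ)ᴴ

/-- `F` is the canonical (Woronowicz) intertwiner between `u` and `(id ⊗ S²) u`:
`F u = (id ⊗ S²)(u) F` and `Tr F = Tr F⁻¹`. It is used for `u` irreducible unitary and `F`
positive definite; it is then unique. -/
structure IsWoronowiczMatrix {n : ℕ} (u : Matrix (Fin n) (Fin n) H)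
    (F : Matrix (Fin n) (Fin n) ℂ) : Prop where
  intertwines : scalarMatrix H F * u =
    u.map (fun a => HopfAlgebra.antipode ℂ (HopfAlgebra.antipode ℂ a)) * scalarMatrix H F
  trace_eq : F.trace = (F⁻¹).trace

/-- The property that determines the functional `f_z` on `H`:
`(id ⊗ f_z) u = F ^ z` for every irreducible unitary corepresentation `u`, where `F > 0` is the
canonical intertwiner of `u`. -/
def IsWoronowiczFunctional (z : ℂ) (f : H →ₗ[ℂ] ℂ) : Prop :=
  ∀ (n : ℕ) (u : Matrix (Fin n) (Fin n) H) (F : Matrix (Fin n) (Fin n) ℂ) (hF : F.PosDef),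
    IsIrredUnitaryCorep u → IsWoronowiczMatrix u F → u.map f = posDefCpow hF z

open Classical in
/-- Woronowicz's functional `f_z : H → ℂ`, for `z ∈ ℂ`. The value `0` in the other branch is never
taken on a CQG algebra (it would not even be unital). -/
def woronowiczFunctional (H : Type*) [Ring H] [StarRing H] [HopfAlgebra ℂ H] (z : ℂ) :
    H →ₗ[ℂ] ℂ :=
  if h : ∃ f : H →ₗ[ℂ] ℂ, IsWoronowiczFunctional z f then h.choose else 0

end HopfStar

section Coaction

variable {H : Type*} [Ring H] [StarRing H] [HopfAlgebra ℂ H] [StarModule ℂ H]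
variable {A : Type*} [CStarAlgebra A]

/-- The coaction axioms for a (unital) `*`-algebra morphism `v : A → A ⊗ H`:
`(v ⊗ id) v = (id ⊗ Δ) v` and `(id ⊗ ε) v = id`. -/
structure IsCoaction (v : A →⋆ₐ[ℂ] A ⊗[ℂ] H) : Prop where
  coassoc : ∀ a : A,
    TensorProduct.assoc ℂ A H H (LinearMap.rTensor H v.toAlgHom.toLinearMap (v a)) =
      LinearMap.lTensor A (Coalgebra.comul (R := ℂ) (A := H)) (v a)
  counital : ∀ a : A,
    TensorProduct.rid ℂ A (LinearMap.lTensor A (Coalgebra.counit (R := ℂ) (A := H)) (v a)) = a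

/-- The linear map `(id ⊗ f) v : A → A`. -/
def slice (f : H →ₗ[ℂ] ℂ) (v : A →⋆ₐ[ℂ] A ⊗[ℂ] H) : A →ₗ[ℂ] A :=
  (TensorProduct.rid ℂ A).toLinearMap ∘ₗ LinearMap.lTensor A f ∘ₗ v.toAlgHom.toLinearMap

end Coaction

section Trace

variable {A : Type*} [CStarAlgebra A] {ι : Type*} {n : ι → ℕ}

/-- The trace `Tr` of a finite dimensional C*-algebra written as a direct sum of matrix algebras:
on each of them it is the usual, not normalised, trace of matrices. -/
def blockTrace [Fintype ι] (e : A ≃⋆ₐ[ℂ] (∀ i, Matrix (Fin (n i)) (Fin (n i)) ℂ)) :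
    A →ₗ[ℂ] ℂ where
  toFun a := ∑ i, (e a i).trace
  map_add' a b := by simp [Finset.sum_add_distrib]
  map_smul' c a := by simp [Finset.mul_sum]

/-- `Q > 0`: every matrix block of `Q` is positive definite (so `Q` is positive and invertible). -/
def IsPos (e : A ≃⋆ₐ[ℂ] (∀ i, Matrix (Fin (n i)) (Fin (n i)) ℂ)) (Q : A) : Prop :=
  ∀ i, (e Q i).PosDef

/-- The number `Tr(B⁻⁴)`, where `B` is the `i`-th matrix block of `Q`. -/
def blockInvTrace (e : A ≃⋆ₐ[ℂ] (∀ i, Matrix (Fin (n i)) (Fin (n i)) ℂ)) (Q : A) (i : ι) : ℂ :=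
  (((e Q i)⁻¹) ^ 4).trace

/-- The linear form `Tr(Q⁴ ·)`. -/
def weightForm [Fintype ι] (e : A ≃⋆ₐ[ℂ] (∀ i, Matrix (Fin (n i)) (Fin (n i)) ℂ)) (Q : A) :
    A →ₗ[ℂ] ℂ :=
  blockTrace e ∘ₗ LinearMap.mulLeft ℂ (Q ^ 4)

/-- `φ` is a `δ`-form: `φ(1) = 1` and `Tr(B⁻⁴) = δ²` for every matrix block `B` of the (unique)
`Q > 0` such that `φ = Tr(Q⁴ ·)`. -/
def IsDeltaForm [Fintype ι] (e : A ≃⋆ₐ[ℂ] (∀ i, Matrix (Fin (n i)) (Fin (n i)) ℂ)) (δ : ℝ)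
    (φ : A →ₗ[ℂ] ℂ) : Prop :=
  φ 1 = 1 ∧ ∃ Q : A, IsPos e Q ∧ φ = weightForm e Q ∧ ∀ i, blockInvTrace e Q i = (δ : ℂ) ^ 2

variable {H : Type*} [Ring H] [StarRing H] [HopfAlgebra ℂ H] [StarModule ℂ H]

/-- The four conditions on `Q ∈ A` relative to a coaction `v`. -/
structure IsCanonicalWeight [Fintype ι]
    (e : A ≃⋆ₐ[ℂ] (∀ i, Matrix (Fin (n i)) (Fin (n i)) ℂ)) (v : A →⋆ₐ[ℂ] A ⊗[ℂ] H) (Q : A) :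
    Prop where
  /-- `ad(Q) = (id ⊗ f_{1/4}) v`, with `ad(Q)(a) = Q a Q⁻¹`. -/
  ad_eq : ∀ a : A, Q * a * Ring.inverse Q = slice (woronowiczFunctional H (1 / 4)) v a
  pos : IsPos e Q
  trace_eq : blockTrace e (Q ^ 4) = 1
  blocks_eq : ∀ i j, blockInvTrace e Q i = blockInvTrace e Q j

end Trace

end QuantumCoaction

end

open scoped TensorProduct Matrix ComplexOrder
noncomputable section
namespace QuantumCoaction

/-! ### Positive definite matrices, and the bicommutant theorem for `*`-algebras of matrices. -/

section MatrixLemmas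

variable {I J : Type*} [Fintype I] [Fintype J]

/-! Write f = f_{1/4} and θ = (id ⊗ f) v. Two facts about f carry the proof: f is multiplicative,
and f(w) is positive definite for every unitary corepresentation w. The first makes θ
multiplicative. Applying f to w*w = 1 shows moreover that a ↦ θ(a*)* inverts θ. Finally, v becomes a
unitary corepresentation in suitable coordinates, so θ is a positive operator for some inner product
on A (`IsCoaction.exists_posDef`).

Such a θ permutes the finitely many central idempotents, and a positive operator fixes its periodic
vectors, so θ preserves each matrix block. There it is inner, m ↦ BmB⁻¹. The formula for the inverse
makes B proportional to B*, hence Hermitian up to a scalar; the eigenvalues of θ are the quotients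
of those of B, and their positivity makes B definite (`exists_posDef_conj_pi`). Each block is thus
determined up to a positive scalar. Condition (iv) fixes these scalars up to a common factor and
(iii) fixes the factor (`exists_normalized_weight`, `IsCanonicalWeight.unique`).

The facts about f are obtained without a Haar state. For any unitary w, irreducible or not, consider
a positive intertwiner F from w to S²(w) with Tr(TF) = Tr(TF⁻¹) for every self-intertwiner T of w.
This normalisation passes to direct sums, unitary equivalents and tensor products
(`IsCanonicalIntertwiner.tensor`), and it forces F to commute with all self-intertwiners. By the
bicommutant theorem the fourth root of F is then (id ⊗ g) w for some functional g, and these g glue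
to a single functional (`exists_quarter_functional`). Existence of F reduces to irreducible w and to
unitarizing the conjugate of w, where averaging over a Casimir element replaces integration
(`IsCorep.exists_posDef`). -/

theorem eq_zero_of_trace_eq_zero {F : Matrix I I ℂ} (hF : F.PosDef) {D : Matrix I J ℂ}
    (h : (Dᴴ * F * D).trace = 0) : D = 0 := by
  classical
  have h0 : Dᴴ * F * D = 0 :=
    (hF.posSemidef.conjTranspose_mul_mul_same D).trace_eq_zero_iff.1 h
  refine Matrix.ext_of_mulVec_single fun j => ?_
  by_contra hne
  rw [Matrix.zero_mulVec] at hne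
  have h1 := hF.dotProduct_mulVec_pos hne
  rw [Matrix.star_mulVec, ← Matrix.dotProduct_mulVec, Matrix.mulVec_mulVec, Matrix.mulVec_mulVec,
    h0] at h1
  simp at h1

variable [DecidableEq I] [DecidableEq J]

/-- The defect Y = RT − TS satisfies RY = −YS, so the nonnegative numbers Tr(Y*RY) and Tr(YSY*) are
opposite and both vanish. Used twice, this carries commutation from a fourth power down to its
positive root. -/
theorem mul_eq_mul_of_sq {R : Matrix I I ℂ} {S : Matrix J J ℂ} (hR : R.PosDef) (hS : S.PosDef)
    {T : Matrix I J ℂ} (h : R ^ 2 * T = T * S ^ 2) : R * T = T * S := by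
  have hY : R * (R * T - T * S) = -((R * T - T * S) * S) := by
    rw [Matrix.mul_sub, Matrix.sub_mul]
    simp only [pow_two, Matrix.mul_assoc] at h ⊢
    rw [h]; abel
  set Y := R * T - T * S with hYdef
  have h1 : (Yᴴ * R * Y).trace = -(Y * S * Yᴴ).trace := by
    rw [Matrix.mul_assoc, hY, Matrix.mul_neg, Matrix.trace_neg, Matrix.trace_mul_comm]
  have h2 := (hR.posSemidef.conjTranspose_mul_mul_same Y).trace_nonneg
  have h3 := (hS.posSemidef.mul_mul_conjTranspose_same Y).trace_nonneg
  have h4 : (Yᴴ * R * Y).trace = 0 := le_antisymm (by rw [h1]; exact neg_nonpos.2 h3) h2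
  exact sub_eq_zero.1 (eq_zero_of_trace_eq_zero hR h4)

theorem posDef_pow {R : Matrix I I ℂ} (hR : R.PosDef) (k : ℕ) : (R ^ k).PosDef :=
  (hR.posSemidef.pow k).posDef_iff_isUnit.2 (hR.isUnit.pow k)

theorem mul_eq_mul_of_pow_four {R : Matrix I I ℂ} {S : Matrix J J ℂ} (hR : R.PosDef)
    (hS : S.PosDef) {T : Matrix I J ℂ} (h : R ^ 4 * T = T * S ^ 4) : R * T = T * S := by
  apply mul_eq_mul_of_sq hR hS
  apply mul_eq_mul_of_sq (posDef_pow hR 2) (posDef_pow hS 2)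
  rwa [← pow_mul, ← pow_mul]

theorem eq_of_pow_four_eq {R S : Matrix I I ℂ} (hR : R.PosDef) (hS : S.PosDef)
    (h : R ^ 4 = S ^ 4) : R = S := by
  have := mul_eq_mul_of_pow_four hR hS (T := 1) (by simpa using h)
  simpa using this

theorem posDef_unitary_conj_diagonal {U : Matrix I I ℂ} (hU : U * Uᴴ = 1) {d : I → ℝ}
    (hd : ∀ i, 0 < d i) :
    (U * Matrix.diagonal (fun i => (d i : ℂ)) * Uᴴ).PosDef := by
  have hu : IsUnit U := IsUnit.of_mul_eq_one _ hU
  refine (Matrix.IsUnit.posDef_star_right_conjugate_iff hu).2 ?_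
  exact Matrix.posDef_diagonal_iff.2 fun i => by exact_mod_cast hd i

theorem unitary_conj_diagonal_pow {U : Matrix I I ℂ} (hU : Uᴴ * U = 1) (d : I → ℂ) (k : ℕ) :
    (U * Matrix.diagonal d * Uᴴ) ^ k = U * Matrix.diagonal (fun i => d i ^ k) * Uᴴ := by
  induction k with
  | zero => simp [mul_eq_one_comm.1 hU]
  | succ k ih =>
    rw [pow_succ, ih]
    calc U * Matrix.diagonal (fun i => d i ^ k) * Uᴴ * (U * Matrix.diagonal d * Uᴴ)
        = U * Matrix.diagonal (fun i => d i ^ k) * (Uᴴ * U) * Matrix.diagonal d * Uᴴ := by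
          simp only [Matrix.mul_assoc]
      _ = _ := by
          rw [hU, Matrix.mul_one, Matrix.mul_assoc U, Matrix.diagonal_mul_diagonal]
          simp only [pow_succ]

theorem eigenvectorUnitary_mul_conjTranspose {F : Matrix I I ℂ} (hF : F.IsHermitian) :
    (hF.eigenvectorUnitary : Matrix I I ℂ) * (hF.eigenvectorUnitary : Matrix I I ℂ)ᴴ = 1 :=
  (Matrix.mem_unitaryGroup_iff).1 hF.eigenvectorUnitary.2

theorem eigenvectorUnitary_conjTranspose_mul {F : Matrix I I ℂ} (hF : F.IsHermitian) :
    (hF.eigenvectorUnitary : Matrix I I ℂ)ᴴ * (hF.eigenvectorUnitary : Matrix I I ℂ) = 1 :=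
  (Matrix.mem_unitaryGroup_iff').1 hF.eigenvectorUnitary.2

theorem isHermitian_eq_conj_diagonal {F : Matrix I I ℂ} (hF : F.IsHermitian) :
    F = (hF.eigenvectorUnitary : Matrix I I ℂ) *
      Matrix.diagonal (fun i => ((hF.eigenvalues i : ℝ) : ℂ)) *
      (hF.eigenvectorUnitary : Matrix I I ℂ)ᴴ := by
  conv_lhs => rw [hF.spectral_theorem]
  rfl

theorem exists_fourthRoot {F : Matrix I I ℂ} (hF : F.PosDef) :
    ∃ R : Matrix I I ℂ, R.PosDef ∧ R ^ 4 = F := by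
  have hpos := hF.eigenvalues_pos
  refine ⟨_, posDef_unitary_conj_diagonal (eigenvectorUnitary_mul_conjTranspose hF.isHermitian)
    (d := fun i => hF.isHermitian.eigenvalues i ^ (1 / 4 : ℝ))
    (fun i => Real.rpow_pos_of_pos (hpos i) _), ?_⟩
  rw [unitary_conj_diagonal_pow (eigenvectorUnitary_conjTranspose_mul hF.isHermitian)]
  conv_rhs => rw [isHermitian_eq_conj_diagonal hF.isHermitian]
  congr! 4 with i
  rw [← Complex.ofReal_pow, ← Real.rpow_natCast, ← Real.rpow_mul (hpos i).le]
  norm_num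

/-- On positive reals the principal complex power is the real fourth root, and a matrix has only one
positive definite fourth root. -/
theorem posDefCpow_quarter {n : ℕ} {R F : Matrix (Fin n) (Fin n) ℂ} (hF : F.PosDef)
    (hR : R.PosDef) (h : R ^ 4 = F) : posDefCpow hF (1 / 4) = R := by
  have hpos := hF.eigenvalues_pos
  have key : ∀ i, ((hF.isHermitian.eigenvalues i : ℝ) : ℂ) ^ (1 / 4 : ℂ) =
      ((hF.isHermitian.eigenvalues i ^ (1 / 4 : ℝ) : ℝ) : ℂ) := fun i => by
    rw [Complex.ofReal_cpow (hpos i).le]; norm_num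
  have h1 : posDefCpow hF (1 / 4) = (hF.isHermitian.eigenvectorUnitary : Matrix _ _ ℂ) *
      Matrix.diagonal (fun i => ((hF.isHermitian.eigenvalues i ^ (1 / 4 : ℝ) : ℝ) : ℂ)) *
      (hF.isHermitian.eigenvectorUnitary : Matrix _ _ ℂ)ᴴ := by
    unfold posDefCpow; simp only [key]
  rw [h1]
  refine eq_of_pow_four_eq (posDef_unitary_conj_diagonal
    (eigenvectorUnitary_mul_conjTranspose hF.isHermitian)
    (fun i => Real.rpow_pos_of_pos (hpos i) _)) hR ?_
  rw [unitary_conj_diagonal_pow (eigenvectorUnitary_conjTranspose_mul hF.isHermitian), h]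
  conv_rhs => rw [isHermitian_eq_conj_diagonal hF.isHermitian]
  congr! 4 with i
  rw [← Complex.ofReal_pow, ← Real.rpow_natCast, ← Real.rpow_mul (hpos i).le]
  norm_num

/-- An orthonormal basis of K for the inner product Tr(a*b); only the expansion formula is needed
later. -/
theorem exists_parseval_frame (K : Submodule ℂ (Matrix I I ℂ)) :
    ∃ (m : ℕ) (e : Fin m → Matrix I I ℂ), (∀ α, e α ∈ K) ∧
      ∀ a ∈ K, a = ∑ α, ((e α)ᴴ * a).trace • e α := by
  let E := EuclideanSpace ℂ (I × I)
  let toM : E ≃ₗ[ℂ] Matrix I I ℂ :=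
    (WithLp.linearEquiv 2 ℂ (I × I → ℂ)).trans (LinearEquiv.curry ℂ ℂ I I)
  have hin : ∀ x y : E, inner ℂ x y = ((toM x)ᴴ * toM y).trace := fun x y => by
    rw [PiLp.inner_apply, Fintype.sum_prod_type, Finset.sum_comm]
    simp only [Matrix.trace, Matrix.diag, Matrix.mul_apply, Matrix.conjTranspose_apply]
    refine Finset.sum_congr rfl fun i _ => Finset.sum_congr rfl fun j _ => ?_
    rw [RCLike.inner_apply]
    exact mul_comm _ _
  let K' : Submodule ℂ E := K.comap toM.toLinearMap
  let b := stdOrthonormalBasis ℂ K'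
  refine ⟨_, fun α => toM (b α : E), fun α => (b α).2, fun a ha => ?_⟩
  have hx : toM.symm a ∈ K' := by simpa [K'] using ha
  have h1 := congrArg (fun y : K' => toM (y : E)) (b.sum_repr' ⟨toM.symm a, hx⟩)
  simp only [Submodule.coe_sum, Submodule.coe_smul, map_sum, map_smul, Submodule.coe_inner,
    hin, LinearEquiv.apply_symm_apply] at h1
  exact h1.symm

/-- The Casimir identity `∑ eᵅ* ⊗ (eᵅ a) = ∑ (a eᵅ*) ⊗ eᵅ`, in coordinates. -/
theorem exists_casimir_coeff {K : Submodule ℂ (Matrix I I ℂ)}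
    (hmul : ∀ a ∈ K, ∀ b ∈ K, a * b ∈ K)
    {m : ℕ} {e : Fin m → Matrix I I ℂ} (he : ∀ α, e α ∈ K)
    (hfr : ∀ a ∈ K, a = ∑ α, ((e α)ᴴ * a).trace • e α) {a : Matrix I I ℂ} (ha : a ∈ K)
    (ha' : aᴴ ∈ K) :
    ∃ c : Fin m → Fin m → ℂ, (∀ α, e α * a = ∑ β, c α β • e β) ∧
      ∀ β, e β * aᴴ = ∑ α, star (c α β) • e α := by
  refine ⟨fun α β => ((e β)ᴴ * (e α * a)).trace, fun α => hfr _ (hmul _ (he α) _ ha),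
    fun β => ?_⟩
  conv_lhs => rw [hfr _ (hmul _ (he β) _ ha')]
  refine Finset.sum_congr rfl fun α _ => ?_
  congr 1
  rw [← Matrix.trace_conjTranspose]
  simp only [Matrix.conjTranspose_mul, Matrix.conjTranspose_conjTranspose]
  rw [Matrix.mul_assoc, Matrix.trace_mul_comm aᴴ, Matrix.mul_assoc]

/-- The bicommutant theorem for a unital `*`-algebra of matrices. -/
theorem mem_of_commute_commutant {K : Submodule ℂ (Matrix I I ℂ)} (h1 : 1 ∈ K)
    (hmul : ∀ a ∈ K, ∀ b ∈ K, a * b ∈ K) (hstar : ∀ a ∈ K, aᴴ ∈ K) {X : Matrix I I ℂ}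
    (hX : ∀ T : Matrix I I ℂ, (∀ a ∈ K, T * a = a * T) → X * T = T * X) : X ∈ K := by
  obtain ⟨m, e, he, hfr⟩ := exists_parseval_frame K
  -- By the Casimir identity, ∑ eᵅ* M eᵅ lies in the commutant of K whatever M is.
  have hcomm : ∀ M : Matrix I I ℂ,
      X * (∑ α, (e α)ᴴ * M * e α) = (∑ α, (e α)ᴴ * M * e α) * X := by
    refine fun M => hX _ fun a ha => ?_
    obtain ⟨c, hc1, hc2⟩ := exists_casimir_coeff hmul he hfr ha (hstar a ha)
    have hc3 : ∀ β, a * (e β)ᴴ = ∑ α, c α β • (e α)ᴴ := fun β => by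
      have := congrArg Matrix.conjTranspose (hc2 β)
      simpa [Matrix.conjTranspose_mul, Matrix.conjTranspose_sum] using this
    simp only [Finset.sum_mul, Finset.mul_sum, Matrix.mul_assoc, hc1]
    simp only [← Matrix.mul_assoc, hc3, Finset.sum_mul, Matrix.mul_smul, Matrix.smul_mul]
    rw [Finset.sum_comm]
  have hone : (1 : Matrix I I ℂ) = ∑ α, (e α).trace • (e α)ᴴ := by
    have := congrArg Matrix.conjTranspose (hfr 1 h1)
    simpa [Matrix.conjTranspose_sum, Matrix.trace_conjTranspose] using this
  have key : X = ∑ α, (e α * X).trace • (e α)ᴴ := by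
    calc X = X * ∑ α, (e α).trace • (e α)ᴴ := by rw [← hone, Matrix.mul_one]
      _ = _ := by
        ext i j
        have h2 : ∀ k, ∑ α, (X * (e α)ᴴ) i j * e α k k = ∑ α, (e α)ᴴ i j * (e α * X) k k := by
          intro k
          -- Taking M to be the matrix unit at (j, k), reading off the entry (i, k) and later
          -- summing over k produces X ∑ Tr(eᵅ) eᵅ* = ∑ Tr(eᵅ X) eᵅ*, whose left side is X.
          have h3 := congrFun (congrFun (hcomm (Matrix.single j k 1)) i) k
          simp only [Finset.mul_sum, Finset.sum_mul] at h3
          rw [Matrix.sum_apply, Matrix.sum_apply] at h3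
          have h4 : ∀ (A B : Matrix I I ℂ), (A * Matrix.single j k (1 : ℂ) * B) i k =
              A i j * B k k := fun A B => by
            simp [Matrix.mul_apply, Matrix.single_apply, Finset.sum_ite_eq, ite_and]
          have h5 : ∀ α, X * ((e α)ᴴ * Matrix.single j k 1 * e α) =
              (X * (e α)ᴴ) * Matrix.single j k 1 * e α := fun α => by simp only [Matrix.mul_assoc]
          have h6 : ∀ α, (e α)ᴴ * Matrix.single j k 1 * e α * X =
              (e α)ᴴ * Matrix.single j k 1 * (e α * X) := fun α => by simp only [Matrix.mul_assoc]
          simpa only [h5, h6, h4] using h3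
        rw [Finset.mul_sum, Matrix.sum_apply, Matrix.sum_apply]
        simp only [Matrix.mul_smul, Matrix.smul_apply, smul_eq_mul, Matrix.trace, Matrix.diag,
          Finset.sum_mul]
        rw [Finset.sum_comm]
        conv_rhs => rw [Finset.sum_comm]
        refine Finset.sum_congr rfl fun k _ => ?_
        simpa only [mul_comm] using h2 k
  rw [key]
  exact Submodule.sum_mem _ fun α _ => Submodule.smul_mem _ _ (hstar _ (he α))

end MatrixLemmas

/-! ### Corepresentations as matrices over `H`: base change, direct sums, tensor products. -/

section Coreps

variable {H : Type*} [Ring H] [HopfAlgebra ℂ H]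
variable {I J K : Type*}

/-- A scalar rectangular matrix, seen as a matrix over `H`. -/
def toH (H : Type*) [Ring H] [HopfAlgebra ℂ H] (T : Matrix I J ℂ) : Matrix I J H :=
  T.map (algebraMap ℂ H)

theorem toH_apply (T : Matrix I J ℂ) (i : I) (j : J) : toH H T i j = algebraMap ℂ H (T i j) := rfl

theorem toH_mul [Fintype J] (S : Matrix I J ℂ) (T : Matrix J K ℂ) :
    toH H (S * T) = toH H S * toH H T :=
  Matrix.map_mul

theorem toH_one [DecidableEq I] : toH H (1 : Matrix I I ℂ) = 1 :=
  Matrix.map_one _ (map_zero _) (map_one _)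

theorem toH_conjTranspose [StarRing H] [StarModule ℂ H] (T : Matrix I J ℂ) :
    (toH H T)ᴴ = toH H Tᴴ := by
  ext i j
  rw [Matrix.conjTranspose_apply, toH_apply, toH_apply, ← algebraMap_star_comm]
  rfl

theorem toH_mul_apply [Fintype J] (T : Matrix I J ℂ) (w : Matrix J K H) (i : I) (k : K) :
    (toH H T * w) i k = ∑ j, T i j • w j k := by
  simp [Matrix.mul_apply, toH_apply, Algebra.smul_def]

theorem mul_toH_apply [Fintype J] (w : Matrix I J H) (T : Matrix J K ℂ) (i : I) (k : K) :
    (w * toH H T) i k = ∑ j, T j k • w i j := by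
  simp [Matrix.mul_apply, toH_apply, Algebra.smul_def, Algebra.commutes]

theorem map_toH_mul [Fintype J] (f : H →ₗ[ℂ] ℂ) (T : Matrix I J ℂ) (w : Matrix J K H) :
    (toH H T * w).map f = T * w.map f := by
  ext i k
  rw [Matrix.map_apply, toH_mul_apply, map_sum, Matrix.mul_apply]
  simp

theorem map_mul_toH [Fintype J] (f : H →ₗ[ℂ] ℂ) (w : Matrix I J H) (T : Matrix J K ℂ) :
    (w * toH H T).map f = w.map f * T := by
  ext i k
  rw [Matrix.map_apply, mul_toH_apply, map_sum, Matrix.mul_apply]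
  simp [mul_comm]

theorem mapH_toH_mul [Fintype J] (f : H →ₗ[ℂ] H) (T : Matrix I J ℂ) (w : Matrix J K H) :
    (toH H T * w).map f = toH H T * w.map f := by
  ext i k
  simp [toH_mul_apply]

theorem mapH_mul_toH [Fintype J] (f : H →ₗ[ℂ] H) (w : Matrix I J H) (T : Matrix J K ℂ) :
    (w * toH H T).map f = w.map f * toH H T := by
  ext i k
  simp [mul_toH_apply]

/-- Linear functionals separate matrices over `H`. -/
theorem matrix_eq_of_map_eq {u w : Matrix I J H} (h : ∀ f : H →ₗ[ℂ] ℂ, u.map f = w.map f) :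
    u = w := by
  ext i j
  rw [← sub_eq_zero, ← Module.forall_dual_apply_eq_zero_iff ℂ]
  intro f
  have := congrFun (congrFun (h f) i) j
  simpa [sub_eq_zero] using this

/-- The convolution product of linear functionals. -/
def conv (f g : H →ₗ[ℂ] ℂ) : H →ₗ[ℂ] ℂ :=
  LinearMap.mul' ℂ ℂ ∘ₗ TensorProduct.map f g ∘ₗ Coalgebra.comul

variable [Fintype I] [DecidableEq I] [Fintype J] [DecidableEq J]

/-- A finite dimensional corepresentation, not necessarily unitary, with any index type. -/
structure IsCorep (u : Matrix I I H) : Prop where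
  comul_apply : ∀ i j, Coalgebra.comul (R := ℂ) (u i j) = ∑ k, u i k ⊗ₜ[ℂ] u k j
  counit_apply : ∀ i j, Coalgebra.counit (R := ℂ) (u i j) = if i = j then 1 else 0

theorem IsCorep.map_conv {u : Matrix I I H} (hu : IsCorep u) (f g : H →ₗ[ℂ] ℂ) :
    u.map (conv f g) = u.map f * u.map g := by
  ext i j
  simp [conv, hu.comul_apply, Matrix.mul_apply]

theorem IsCorep.map_counit {u : Matrix I I H} (hu : IsCorep u) :
    u.map (Coalgebra.counit (R := ℂ) (A := H)) = 1 := by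
  ext i j
  simp [hu.counit_apply, Matrix.one_apply]

theorem IsCorep.antipode_mul_self {u : Matrix I I H} (hu : IsCorep u) :
    u.map (HopfAlgebra.antipode ℂ) * u = 1 := by
  ext i j
  have := HopfAlgebra.mul_antipode_rTensor_comul_apply (R := ℂ) (u i j)
  rw [hu.comul_apply, hu.counit_apply] at this
  simpa [Matrix.mul_apply, Matrix.one_apply, apply_ite (algebraMap ℂ H)] using this

theorem IsCorep.self_mul_antipode {u : Matrix I I H} (hu : IsCorep u) :
    u * u.map (HopfAlgebra.antipode ℂ) = 1 := by
  ext i j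
  have := HopfAlgebra.mul_antipode_lTensor_comul_apply (R := ℂ) (u i j)
  rw [hu.comul_apply, hu.counit_apply] at this
  simpa [Matrix.mul_apply, Matrix.one_apply, apply_ite (algebraMap ℂ H)] using this

/-- An algebra morphism applied entrywise respects matrix products, so with the axioms in this form
base change and direct sums become plain matrix algebra. -/
theorem isCorep_iff {u : Matrix I I H} : IsCorep u ↔
    u.map (Bialgebra.comulAlgHom ℂ H) =
      u.map (Algebra.TensorProduct.includeLeft : H →ₐ[ℂ] H ⊗[ℂ] H) *
        u.map (Algebra.TensorProduct.includeRight : H →ₐ[ℂ] H ⊗[ℂ] H) ∧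
    u.map (Bialgebra.counitAlgHom ℂ H) = 1 := by
  constructor
  · rintro ⟨h1, h2⟩
    constructor
    · ext i j
      simp [Matrix.mul_apply, h1]
    · ext i j
      simp [Matrix.one_apply, h2]
  · rintro ⟨h1, h2⟩
    constructor
    · intro i j
      have := congrFun (congrFun h1 i) j
      simpa [Matrix.mul_apply] using this
    · intro i j
      have := congrFun (congrFun h2 i) j
      simpa [Matrix.one_apply] using this

theorem toH_map_algHom {B : Type*} [Ring B] [Algebra ℂ B] (φ : H →ₐ[ℂ] B) (T : Matrix I J ℂ) :
    (toH H T).map φ = T.map (algebraMap ℂ B) := by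
  ext i j
  simp [toH_apply]

theorem IsCorep.congr {u : Matrix I I H} (hu : IsCorep u)
    {V : Matrix J I ℂ} {W : Matrix I J ℂ} (hVW : V * W = 1) (hWV : W * V = 1) :
    IsCorep (toH H V * u * toH H W) := by
  obtain ⟨h1, h2⟩ := isCorep_iff.1 hu
  refine isCorep_iff.2 ⟨?_, ?_⟩
  · simp only [Matrix.map_mul, toH_map_algHom, h1]
    have h3 : W.map (algebraMap ℂ (H ⊗[ℂ] H)) * V.map (algebraMap ℂ (H ⊗[ℂ] H)) = 1 := by
      rw [← Matrix.map_mul, hWV, Matrix.map_one _ (map_zero _) (map_one _)]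
    simp only [Matrix.mul_assoc]
    rw [← Matrix.mul_assoc (W.map _), h3, Matrix.one_mul]
  · simp only [Matrix.map_mul, toH_map_algHom, h2, Matrix.mul_one]
    rw [← Matrix.map_mul, hVW, Matrix.map_one _ (map_zero _) (map_one _)]

theorem IsCorep.fromBlocks {u : Matrix I I H} {w : Matrix J J H} (hu : IsCorep u)
    (hw : IsCorep w) : IsCorep (Matrix.fromBlocks u 0 0 w) := by
  obtain ⟨h1, h2⟩ := isCorep_iff.1 hu
  obtain ⟨h3, h4⟩ := isCorep_iff.1 hw
  refine isCorep_iff.2 ⟨?_, ?_⟩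
  · simp [Matrix.fromBlocks_map, Matrix.fromBlocks_multiply, h1, h3]
  · simp [Matrix.fromBlocks_map, h2, h4]

/-- The tensor product of two matrices over `H`. -/
def tensorMat (u : Matrix I I H) (w : Matrix J J H) : Matrix (I × J) (I × J) H :=
  Matrix.of fun p q => u p.1 q.1 * w p.2 q.2

theorem IsCorep.tensor {u : Matrix I I H} {w : Matrix J J H} (hu : IsCorep u)
    (hw : IsCorep w) : IsCorep (tensorMat u w) where
  comul_apply p q := by
    simp only [tensorMat, Matrix.of_apply, Bialgebra.comul_mul, hu.comul_apply, hw.comul_apply,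
      Finset.sum_mul_sum, Algebra.TensorProduct.tmul_mul_tmul, Fintype.sum_prod_type]
  counit_apply p q := by
    simp only [tensorMat, Matrix.of_apply, Bialgebra.counit_mul, hu.counit_apply,
      hw.counit_apply, Prod.ext_iff, ite_and, mul_ite, mul_one, mul_zero]
    split_ifs <;> rfl

/-- The space of coefficients of a matrix. -/
def coeffSpace (u : Matrix I I H) : Submodule ℂ H :=
  Submodule.span ℂ (Set.range fun p : I × I => u p.1 p.2)

omit [Fintype I] [DecidableEq I] in
theorem coeff_mem (u : Matrix I I H) (i j : I) : u i j ∈ coeffSpace u :=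
  Submodule.subset_span ⟨(i, j), rfl⟩

omit [Fintype I] [DecidableEq I] in
theorem eq_of_mem_coeffSpace {M : Type*} [AddCommGroup M] [Module ℂ M] {u : Matrix I I H}
    {f g : H →ₗ[ℂ] M} (h : u.map f = u.map g) {a : H} (ha : a ∈ coeffSpace u) : f a = g a := by
  refine LinearMap.eqOn_span ?_ ha
  rintro _ ⟨p, rfl⟩
  exact congrFun (congrFun h p.1) p.2

variable [StarRing H]

/-- A finite dimensional unitary corepresentation, with any index type. -/
structure IsUCorep (u : Matrix I I H) : Prop extends IsCorep u where
  conjTranspose_mul_self : uᴴ * u = 1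
  mul_conjTranspose_self : u * uᴴ = 1

theorem IsUnitaryCorep.isUCorep {n : ℕ} {u : Matrix (Fin n) (Fin n) H} (hu : IsUnitaryCorep u) :
    IsUCorep u :=
  ⟨⟨hu.comul_apply, hu.counit_apply⟩, hu.conjTranspose_mul_self, hu.mul_conjTranspose_self⟩

theorem IsUCorep.isUnitaryCorep {n : ℕ} {u : Matrix (Fin n) (Fin n) H} (hu : IsUCorep u) :
    IsUnitaryCorep u :=
  ⟨hu.comul_apply, hu.counit_apply, hu.conjTranspose_mul_self, hu.mul_conjTranspose_self⟩

theorem IsUCorep.antipode {u : Matrix I I H} (hu : IsUCorep u) :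
    u.map (HopfAlgebra.antipode ℂ) = uᴴ := by
  calc u.map (HopfAlgebra.antipode ℂ) = u.map (HopfAlgebra.antipode ℂ) * (u * uᴴ) := by
        rw [hu.mul_conjTranspose_self, Matrix.mul_one]
    _ = uᴴ := by rw [← Matrix.mul_assoc, hu.antipode_mul_self, Matrix.one_mul]

theorem IsUCorep.congr [StarModule ℂ H] {u : Matrix I I H} (hu : IsUCorep u) {V : Matrix J I ℂ}
    (h1 : V * Vᴴ = 1) (h2 : Vᴴ * V = 1) : IsUCorep (toH H V * u * toH H Vᴴ) where
  toIsCorep := hu.toIsCorep.congr h1 h2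
  conjTranspose_mul_self := by
    simp only [Matrix.conjTranspose_mul, toH_conjTranspose, Matrix.conjTranspose_conjTranspose]
    calc _ = toH H V * (uᴴ * (toH H Vᴴ * toH H V) * u) * toH H Vᴴ := by
          simp only [Matrix.mul_assoc]
      _ = 1 := by
          rw [← toH_mul, h2, toH_one, Matrix.mul_one, hu.conjTranspose_mul_self, Matrix.mul_one,
            ← toH_mul, h1, toH_one]
  mul_conjTranspose_self := by
    simp only [Matrix.conjTranspose_mul, toH_conjTranspose, Matrix.conjTranspose_conjTranspose]
    calc _ = toH H V * (u * (toH H Vᴴ * toH H V) * uᴴ) * toH H Vᴴ := by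
          simp only [Matrix.mul_assoc]
      _ = 1 := by
          rw [← toH_mul, h2, toH_one, Matrix.mul_one, hu.mul_conjTranspose_self, Matrix.mul_one,
            ← toH_mul, h1, toH_one]

theorem IsUCorep.fromBlocks {u : Matrix I I H} {w : Matrix J J H} (hu : IsUCorep u)
    (hw : IsUCorep w) : IsUCorep (Matrix.fromBlocks u 0 0 w) where
  toIsCorep := hu.toIsCorep.fromBlocks hw.toIsCorep
  conjTranspose_mul_self := by
    simp [Matrix.fromBlocks_conjTranspose, Matrix.fromBlocks_multiply, hu.conjTranspose_mul_self,
      hw.conjTranspose_mul_self]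
  mul_conjTranspose_self := by
    simp [Matrix.fromBlocks_conjTranspose, Matrix.fromBlocks_multiply, hu.mul_conjTranspose_self,
      hw.mul_conjTranspose_self]

theorem isUCorep_of_fromBlocks {u : Matrix I I H} {w : Matrix J J H}
    (h : IsUCorep (Matrix.fromBlocks u 0 0 w)) : IsUCorep u ∧ IsUCorep w := by
  obtain ⟨h1, h2⟩ := isCorep_iff.1 h.toIsCorep
  have h3 := h.conjTranspose_mul_self
  have h4 := h.mul_conjTranspose_self
  simp only [Matrix.fromBlocks_map, Matrix.fromBlocks_multiply, Matrix.fromBlocks_conjTranspose,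
    ← Matrix.fromBlocks_one, Matrix.fromBlocks_inj] at h1 h2 h3 h4
  refine ⟨⟨isCorep_iff.2 ⟨?_, h2.1⟩, ?_, ?_⟩, ⟨isCorep_iff.2 ⟨?_, h2.2.2.2⟩, ?_, ?_⟩⟩
  · simpa using h1.1
  · simpa using h3.1
  · simpa using h4.1
  · simpa using h1.2.2.2
  · simpa using h3.2.2.2
  · simpa using h4.2.2.2

theorem IsUCorep.tensor {u : Matrix I I H} {w : Matrix J J H} (hu : IsUCorep u)
    (hw : IsUCorep w) : IsUCorep (tensorMat u w) where
  toIsCorep := hu.toIsCorep.tensor hw.toIsCorep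
  conjTranspose_mul_self := by
    ext p q
    have h1 : ∀ i j, ∑ k, star (u k i) * u k j = if i = j then 1 else 0 := fun i j => by
      have := congrFun (congrFun hu.conjTranspose_mul_self i) j
      simpa [Matrix.mul_apply, Matrix.one_apply] using this
    have h2 : ∀ i j, ∑ k, star (w k i) * w k j = if i = j then 1 else 0 := fun i j => by
      have := congrFun (congrFun hw.conjTranspose_mul_self i) j
      simpa [Matrix.mul_apply, Matrix.one_apply] using this
    calc _ = ∑ l, star (w l p.2) * (∑ k, star (u k p.1) * u k q.1) * w l q.2 := by
          simp only [Matrix.mul_apply, Matrix.conjTranspose_apply, tensorMat, Matrix.of_apply,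
            Fintype.sum_prod_type, star_mul, Finset.mul_sum, Finset.sum_mul, mul_assoc]
          rw [Finset.sum_comm]
      _ = _ := by
          simp only [h1, mul_ite, mul_one, mul_zero, ite_mul, zero_mul, Matrix.one_apply,
            Prod.ext_iff, ite_and]
          split_ifs with h3 <;> simp_all
  mul_conjTranspose_self := by
    ext p q
    have h1 : ∀ i j, ∑ k, u i k * star (u j k) = if i = j then 1 else 0 := fun i j => by
      have := congrFun (congrFun hu.mul_conjTranspose_self i) j
      simpa [Matrix.mul_apply, Matrix.one_apply] using this
    have h2 : ∀ i j, ∑ k, w i k * star (w j k) = if i = j then 1 else 0 := fun i j => by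
      have := congrFun (congrFun hw.mul_conjTranspose_self i) j
      simpa [Matrix.mul_apply, Matrix.one_apply] using this
    calc _ = ∑ k, u p.1 k * (∑ l, w p.2 l * star (w q.2 l)) * star (u q.1 k) := by
          simp only [Matrix.mul_apply, Matrix.conjTranspose_apply, tensorMat, Matrix.of_apply,
            Fintype.sum_prod_type, star_mul, Finset.mul_sum, Finset.sum_mul, mul_assoc]
      _ = _ := by
          simp only [h2, mul_ite, mul_one, mul_zero, ite_mul, zero_mul, Matrix.one_apply,
            Prod.ext_iff, ite_and]
          split_ifs with h3 <;> simp_all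

end Coreps

/-! ### Unitarizability of finite dimensional corepresentations, and intertwiners with S². -/

section Unitarization

variable {H : Type*} [Ring H] [HopfAlgebra ℂ H]
variable {I J : Type*} [Fintype I] [DecidableEq I] [Fintype J] [DecidableEq J]

/-- Evaluation of linear functionals on a matrix over `H`. -/
def evalMatrix (x : Matrix I I H) : (H →ₗ[ℂ] ℂ) →ₗ[ℂ] Matrix I I ℂ where
  toFun f := x.map f
  map_add' _ _ := rfl
  map_smul' _ _ := rfl

/-- The algebra of matrices `(id ⊗ f) x`, for `f` a linear functional. -/
def dualImage (x : Matrix I I H) : Submodule ℂ (Matrix I I ℂ) :=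
  LinearMap.range (evalMatrix x)

theorem mem_dualImage {x : Matrix I I H} {a : Matrix I I ℂ} :
    a ∈ dualImage x ↔ ∃ f : H →ₗ[ℂ] ℂ, x.map f = a := Iff.rfl

theorem one_mem_dualImage {x : Matrix I I H} (hx : IsCorep x) : 1 ∈ dualImage x :=
  ⟨_, hx.map_counit⟩

theorem mul_mem_dualImage {x : Matrix I I H} (hx : IsCorep x) :
    ∀ a ∈ dualImage x, ∀ b ∈ dualImage x, a * b ∈ dualImage x := by
  rintro _ ⟨f, rfl⟩ _ ⟨g, rfl⟩
  exact ⟨conv f g, hx.map_conv f g⟩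

variable [StarRing H] [StarModule ℂ H]

/-- The adjoint `a ↦ conj (f (S(a)*))` of a linear functional. -/
def sharp (f : H →ₗ[ℂ] ℂ) : H →ₗ[ℂ] ℂ where
  toFun a := star (f (star (HopfAlgebra.antipode ℂ a)))
  map_add' a b := by simp
  map_smul' c a := by simp

theorem IsUCorep.map_sharp {x : Matrix I I H} (hx : IsUCorep x) (f : H →ₗ[ℂ] ℂ) :
    x.map (sharp f) = (x.map f)ᴴ := by
  ext i j
  have h : HopfAlgebra.antipode ℂ (x i j) = star (x j i) :=
    congrFun (congrFun hx.antipode i) j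
  simp [sharp, h]

theorem conjTranspose_mem_dualImage {x : Matrix I I H} (hx : IsUCorep x) :
    ∀ a ∈ dualImage x, aᴴ ∈ dualImage x := by
  rintro _ ⟨f, rfl⟩
  exact ⟨sharp f, hx.map_sharp f⟩

/-- A matrix commuting with the self-intertwiners of `x` is of the form `(id ⊗ f) x`. -/
theorem exists_functional {x : Matrix I I H} (hx : IsUCorep x) {X : Matrix I I ℂ}
    (hX : ∀ T : Matrix I I ℂ, toH H T * x = x * toH H T → X * T = T * X) :
    ∃ f : H →ₗ[ℂ] ℂ, x.map f = X := by
  refine mem_dualImage.1 (mem_of_commute_commutant (one_mem_dualImage hx.toIsCorep)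
    (mul_mem_dualImage hx.toIsCorep) (conjTranspose_mem_dualImage hx) fun T hT => hX T ?_)
  refine matrix_eq_of_map_eq fun f => ?_
  rw [map_toH_mul, map_mul_toH]
  exact hT _ ⟨f, rfl⟩

/-- Every corepresentation with coefficients in the coefficient space of a unitary one is
unitarizable. -/
theorem IsCorep.exists_posDef {x : Matrix I I H} (hx : IsUCorep x) {p : Matrix J J H}
    (hp : IsCorep p) (h : ∀ i j, p i j ∈ coeffSpace x) :
    ∃ G : Matrix J J ℂ, G.PosDef ∧ pᴴ * toH H G * p = toH H G := by
  obtain ⟨m, e, he, hfr⟩ := exists_parseval_frame (dualImage x)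
  choose φ hφ using fun α => mem_dualImage.1 (he α)
  -- The matrix (id ⊗ f) p depends only on (id ⊗ f) x, so identities in `dualImage x` transfer to p.
  have hext : ∀ f g : H →ₗ[ℂ] ℂ, x.map f = x.map g → p.map f = p.map g := fun f g hfg => by
    ext i j
    exact eq_of_mem_coeffSpace hfg (h i j)
  -- The image under p of the Casimir element ∑ eᵅ* ⊗ eᵅ, with its two legs multiplied. It replaces
  -- the Haar average, and the Casimir identity gives its invariance.
  set G : Matrix J J ℂ := ∑ α, (p.map (φ α))ᴴ * p.map (φ α) with hG
  have hmapsum : ∀ (y : Matrix J J H) (c : Fin m → ℂ),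
      y.map (∑ α, c α • φ α : H →ₗ[ℂ] ℂ) = ∑ α, c α • y.map (φ α) := fun y c => by
    ext i j
    simp [Matrix.sum_apply]
  have hmapsum' : ∀ (c : Fin m → ℂ),
      x.map (∑ α, c α • φ α : H →ₗ[ℂ] ℂ) = ∑ α, c α • x.map (φ α) := fun c => by
    ext i j
    simp [Matrix.sum_apply]
  have hinv : ∀ f : H →ₗ[ℂ] ℂ, G * p.map f = (p.map (sharp f))ᴴ * G := by
    intro f
    obtain ⟨c, hc1, hc2⟩ := exists_casimir_coeff (mul_mem_dualImage hx.toIsCorep) he hfr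
      (mem_dualImage.2 ⟨f, rfl⟩) (mem_dualImage.2 ⟨sharp f, hx.map_sharp f⟩)
    have h1 : ∀ α, p.map (φ α) * p.map f = ∑ β, c α β • p.map (φ β) := fun α => by
      rw [← hp.map_conv, ← hmapsum]
      refine hext _ _ ?_
      rw [hx.map_conv, hmapsum', hφ, hc1]
      simp only [hφ]
    have h2 : ∀ β, p.map (φ β) * p.map (sharp f) = ∑ α, star (c α β) • p.map (φ α) := fun β => by
      rw [← hp.map_conv, ← hmapsum]
      refine hext _ _ ?_
      rw [hx.map_conv, hmapsum', hφ, hx.map_sharp, hc2]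
      simp only [hφ]
    have h3 : ∀ β, (p.map (sharp f))ᴴ * (p.map (φ β))ᴴ = ∑ α, c α β • (p.map (φ α))ᴴ := by
      intro β
      rw [← Matrix.conjTranspose_mul, h2]
      simp [Matrix.conjTranspose_sum]
    rw [hG, Finset.sum_mul, Finset.mul_sum]
    simp only [Matrix.mul_assoc, h1]
    simp only [← Matrix.mul_assoc, h3, Finset.sum_mul, Finset.mul_sum, Matrix.mul_smul,
      Matrix.smul_mul]
    rw [Finset.sum_comm]
  refine ⟨G, ?_, ?_⟩
  · have hpsd : G.PosSemidef :=
      Matrix.posSemidef_sum _ fun α _ => Matrix.posSemidef_conjTranspose_mul_self _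
    refine Matrix.PosDef.of_dotProduct_mulVec_pos hpsd.isHermitian fun v hv => ?_
    refine lt_of_le_of_ne (hpsd.dotProduct_mulVec_nonneg v) fun h0 => hv ?_
    have h1 : star v ⬝ᵥ G *ᵥ v = ∑ α, star (p.map (φ α) *ᵥ v) ⬝ᵥ (p.map (φ α) *ᵥ v) := by
      rw [hG, Matrix.sum_mulVec, dotProduct_sum]
      refine Finset.sum_congr rfl fun α _ => ?_
      rw [Matrix.star_mulVec, ← Matrix.dotProduct_mulVec, Matrix.mulVec_mulVec]
    rw [h1] at h0
    have h2 := (Finset.sum_eq_zero_iff_of_nonneg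
      (fun α _ => dotProduct_star_self_nonneg (p.map (φ α) *ᵥ v))).1 h0.symm
    have h3 : ∀ α, p.map (φ α) *ᵥ v = 0 := fun α =>
      dotProduct_star_self_eq_zero.1 (h2 α (Finset.mem_univ _))
    -- The identity is a combination of the p(φ α), so these matrices have no common kernel vector
    -- and G is definite.
    have h4 : (1 : Matrix J J ℂ) = ∑ α, ((e α)ᴴ * 1).trace • p.map (φ α) := by
      rw [← hmapsum, ← hp.map_counit]
      refine hext _ _ ?_
      rw [hmapsum', hx.map_counit]
      simp only [hφ]
      exact hfr 1 (one_mem_dualImage hx.toIsCorep)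
    rw [← Matrix.one_mulVec v, h4, Matrix.sum_mulVec]
    simp [Matrix.smul_mulVec, h3]
  · have h1 : toH H G * p = (p.map (HopfAlgebra.antipode ℂ))ᴴ * toH H G := by
      refine matrix_eq_of_map_eq fun f => ?_
      rw [map_toH_mul, map_mul_toH, hinv]
      congr 1
      ext i j
      simp [sharp]
    rw [Matrix.mul_assoc, h1, ← Matrix.mul_assoc, ← Matrix.conjTranspose_mul, hp.antipode_mul_self,
      Matrix.conjTranspose_one, Matrix.one_mul]

variable [IsCQGAlgebra H]

theorem IsCorep.conj {u : Matrix I I H} (hu : IsCorep u) : IsCorep (u.map star) where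
  comul_apply i j := by
    simp [IsCQGAlgebra.comul_star, hu.comul_apply, TensorProduct.star_tmul]
  counit_apply i j := by
    simp only [Matrix.map_apply, IsCQGAlgebra.counit_star, hu.counit_apply]
    split_ifs <;> simp

omit [Fintype I] [DecidableEq I] [Fintype J] [DecidableEq J] [StarRing H] [StarModule ℂ H]
  [IsCQGAlgebra H] in
theorem coeffSpace_le_fromBlocks_left (u : Matrix I I H) (w : Matrix J J H) :
    coeffSpace u ≤ coeffSpace (Matrix.fromBlocks u 0 0 w) := by
  refine Submodule.span_mono ?_
  rintro _ ⟨p, rfl⟩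
  exact ⟨(Sum.inl p.1, Sum.inl p.2), rfl⟩

omit [Fintype I] [DecidableEq I] [Fintype J] [DecidableEq J] [StarRing H] [StarModule ℂ H]
  [IsCQGAlgebra H] in
theorem coeffSpace_le_fromBlocks_right (u : Matrix I I H) (w : Matrix J J H) :
    coeffSpace w ≤ coeffSpace (Matrix.fromBlocks u 0 0 w) := by
  refine Submodule.span_mono ?_
  rintro _ ⟨p, rfl⟩
  exact ⟨(Sum.inr p.1, Sum.inr p.2), rfl⟩

/-- Coefficients of two corepresentations are coefficients of their direct sum, so a linear
combination of coefficients already lives in one coefficient space. -/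
theorem exists_mem_coeffSpace (a : H) : ∃ (I : Type) (_ : Fintype I) (_ : DecidableEq I)
    (x : Matrix I I H), IsUCorep x ∧ a ∈ coeffSpace x := by
  have ha : a ∈ Submodule.span ℂ {a : H | ∃ (n : ℕ) (u : Matrix (Fin n) (Fin n) H) (i j : Fin n),
    IsUnitaryCorep u ∧ a = u i j} := by rw [IsCQGAlgebra.span_coeff]; trivial
  induction ha using Submodule.span_induction with
  | mem a ha =>
    obtain ⟨n, u, i, j, hu, rfl⟩ := ha
    exact ⟨Fin n, inferInstance, inferInstance, u, hu.isUCorep, coeff_mem u i j⟩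
  | zero =>
    exact ⟨Empty, inferInstance, inferInstance, fun i => i.elim,
      ⟨⟨fun i => i.elim, fun i => i.elim⟩, by ext i; exact i.elim, by ext i; exact i.elim⟩,
      Submodule.zero_mem _⟩
  | add a b _ _ iha ihb =>
    obtain ⟨I, _, _, x, hx, hxa⟩ := iha
    obtain ⟨J, _, _, y, hy, hyb⟩ := ihb
    exact ⟨I ⊕ J, inferInstance, inferInstance, _, hx.fromBlocks hy,
      Submodule.add_mem _ (coeffSpace_le_fromBlocks_left x y hxa)
        (coeffSpace_le_fromBlocks_right x y hyb)⟩
  | smul c a _ iha =>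
    obtain ⟨I, _, _, x, hx, hxa⟩ := iha
    exact ⟨I, inferInstance, inferInstance, x, hx, Submodule.smul_mem _ c hxa⟩

theorem exists_forall_mem_coeffSpace (s : Finset H) : ∃ (I : Type) (_ : Fintype I)
    (_ : DecidableEq I) (x : Matrix I I H), IsUCorep x ∧ ∀ a ∈ s, a ∈ coeffSpace x := by
  classical
  induction s using Finset.induction_on with
  | empty =>
    obtain ⟨I, h1, h2, x, hx, -⟩ := exists_mem_coeffSpace (0 : H)
    exact ⟨I, h1, h2, x, hx, by simp⟩
  | insert a s _ ih =>
    obtain ⟨I, _, _, x, hx, hxs⟩ := ih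
    obtain ⟨J, _, _, y, hy, hya⟩ := exists_mem_coeffSpace a
    refine ⟨I ⊕ J, inferInstance, inferInstance, _, hx.fromBlocks hy, fun b hb => ?_⟩
    rcases Finset.mem_insert.1 hb with rfl | hb
    · exact coeffSpace_le_fromBlocks_right x y hya
    · exact coeffSpace_le_fromBlocks_left x y (hxs b hb)

/-- Every finite dimensional corepresentation is unitarizable. -/
theorem IsCorep.exists_posDef_invariant {p : Matrix J J H} (hp : IsCorep p) :
    ∃ G : Matrix J J ℂ, G.PosDef ∧ pᴴ * toH H G * p = toH H G := by
  classical
  obtain ⟨I, _, _, x, hx, hxp⟩ := exists_forall_mem_coeffSpace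
    (Finset.univ.image fun q : J × J => p q.1 q.2)
  exact hp.exists_posDef hx fun i j =>
    hxp _ (Finset.mem_image.2 ⟨(i, j), Finset.mem_univ _, rfl⟩)

/-- The square of the antipode. -/
def antipodeSq (H : Type*) [Ring H] [HopfAlgebra ℂ H] : H →ₗ[ℂ] H :=
  HopfAlgebra.antipode ℂ ∘ₗ HopfAlgebra.antipode ℂ

/-- For unitary w one has S(w) = w*, so S²(w) is the transpose of S applied to the conjugate
corepresentation. Transposing an invariant form of the conjugate therefore gives F. -/
theorem IsUCorep.exists_antipodeSq_intertwiner {w : Matrix I I H} (hw : IsUCorep w) :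
    ∃ F : Matrix I I ℂ, F.PosDef ∧ toH H F * w = w.map (antipodeSq H) * toH H F := by
  have hp := hw.toIsCorep.conj
  obtain ⟨G, hG, h⟩ := hp.exists_posDef_invariant
  refine ⟨Gᵀ, hG.transpose, ?_⟩
  have h1 : (w.map star)ᴴ * toH H G =
      toH H G * (w.map star).map (HopfAlgebra.antipode ℂ) := by
    conv_rhs => rw [← h]
    rw [Matrix.mul_assoc _ (w.map star), hp.self_mul_antipode, Matrix.mul_one]
  ext i j
  have h2 := congrFun (congrFun h1 j) i
  rw [mul_toH_apply, toH_mul_apply] at h2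
  rw [mul_toH_apply, toH_mul_apply]
  have h3 : ∀ a b, HopfAlgebra.antipode ℂ (w a b) = star (w b a) := fun a b =>
    congrFun (congrFun hw.antipode a) b
  simpa [antipodeSq, h3] using h2

end Unitarization

/-! ### Self-intertwiners and reduction to irreducible corepresentations. -/

section Decomposition

variable {H : Type*} [Ring H] [HopfAlgebra ℂ H]
variable {I J : Type*}

theorem toH_add (S T : Matrix I J ℂ) : toH H (S + T) = toH H S + toH H T := by
  ext; simp [toH_apply]

theorem toH_sub (S T : Matrix I J ℂ) : toH H (S - T) = toH H S - toH H T := by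
  ext; simp [toH_apply]

theorem toH_smul (c : ℂ) (T : Matrix I J ℂ) : toH H (c • T) = c • toH H T := by
  ext; simp [toH_apply, Algebra.smul_def]

variable [Fintype I] [DecidableEq I] [Fintype J] [DecidableEq J]

/-- `T` commutes with the corepresentation `w`. -/
def IsSelfIntertwiner (w : Matrix I I H) (T : Matrix I I ℂ) : Prop :=
  toH H T * w = w * toH H T

theorem IsSelfIntertwiner.mul {w : Matrix I I H} {S T : Matrix I I ℂ}
    (hS : IsSelfIntertwiner w S) (hT : IsSelfIntertwiner w T) : IsSelfIntertwiner w (S * T) := by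
  unfold IsSelfIntertwiner at *
  rw [toH_mul, Matrix.mul_assoc, hT, ← Matrix.mul_assoc, hS, Matrix.mul_assoc]

theorem IsSelfIntertwiner.add {w : Matrix I I H} {S T : Matrix I I ℂ}
    (hS : IsSelfIntertwiner w S) (hT : IsSelfIntertwiner w T) : IsSelfIntertwiner w (S + T) := by
  unfold IsSelfIntertwiner at *
  rw [toH_add, Matrix.add_mul, Matrix.mul_add, hS, hT]

theorem IsSelfIntertwiner.sub {w : Matrix I I H} {S T : Matrix I I ℂ}
    (hS : IsSelfIntertwiner w S) (hT : IsSelfIntertwiner w T) : IsSelfIntertwiner w (S - T) := by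
  unfold IsSelfIntertwiner at *
  rw [toH_sub, Matrix.sub_mul, Matrix.mul_sub, hS, hT]

theorem IsSelfIntertwiner.smul {w : Matrix I I H} {T : Matrix I I ℂ} (c : ℂ)
    (hT : IsSelfIntertwiner w T) : IsSelfIntertwiner w (c • T) := by
  unfold IsSelfIntertwiner at *
  rw [toH_smul, Matrix.smul_mul, Matrix.mul_smul, hT]

theorem isSelfIntertwiner_one (w : Matrix I I H) : IsSelfIntertwiner w 1 := by
  simp [IsSelfIntertwiner, toH_one]

variable [StarRing H] [StarModule ℂ H]

theorem IsSelfIntertwiner.conjTranspose {w : Matrix I I H} (hw : IsUCorep w) {T : Matrix I I ℂ}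
    (hT : IsSelfIntertwiner w T) : IsSelfIntertwiner w Tᴴ := by
  have h1 : wᴴ * toH H T = toH H T * wᴴ := by
    calc wᴴ * toH H T = wᴴ * toH H T * (w * wᴴ) := by
          rw [hw.mul_conjTranspose_self, Matrix.mul_one]
      _ = wᴴ * (toH H T * w) * wᴴ := by simp only [Matrix.mul_assoc]
      _ = (wᴴ * w) * toH H T * wᴴ := by rw [hT]; simp only [Matrix.mul_assoc]
      _ = _ := by rw [hw.conjTranspose_mul_self, Matrix.one_mul]
  have h2 := congrArg Matrix.conjTranspose h1
  simpa [IsSelfIntertwiner, Matrix.conjTranspose_mul, toH_conjTranspose] using h2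

/-- The Hermitian and anti-Hermitian parts of T are self-intertwiners and cannot both be scalar. -/
theorem exists_hermitian_selfIntertwiner {w : Matrix I I H} (hw : IsUCorep w) {T : Matrix I I ℂ}
    (hT : IsSelfIntertwiner w T) (hns : ¬ ∃ c : ℂ, T = c • (1 : Matrix I I ℂ)) :
    ∃ S : Matrix I I ℂ, S.IsHermitian ∧ IsSelfIntertwiner w S ∧
      ¬ ∃ c : ℂ, S = c • (1 : Matrix I I ℂ) := by
  have hT' := hT.conjTranspose hw
  by_cases h1 : ∃ c : ℂ, T + Tᴴ = c • (1 : Matrix I I ℂ)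
  · refine ⟨Complex.I • (T - Tᴴ), ?_, (hT.sub hT').smul _, ?_⟩
    · simp [Matrix.IsHermitian, Matrix.conjTranspose_smul, Matrix.conjTranspose_sub, ← smul_neg]
    · rintro ⟨d, hd⟩
      obtain ⟨c, hc⟩ := h1
      refine hns ⟨(c - Complex.I * d) / 2, ?_⟩
      have h2 : T - Tᴴ = (-(Complex.I * d)) • (1 : Matrix I I ℂ) := by
        have := congrArg (fun M => (-Complex.I) • M) hd
        simpa [smul_smul] using this
      have h3 : (2 : ℂ) • T = (c - Complex.I * d) • (1 : Matrix I I ℂ) := by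
        rw [sub_eq_add_neg, add_smul, ← hc, ← h2, two_smul]; abel
      rw [div_eq_inv_mul, mul_smul, ← h3, smul_smul]
      norm_num
  · exact ⟨T + Tᴴ, by simp [Matrix.IsHermitian, add_comm], hT.add hT', h1⟩

theorem conj_conj_cancel {V : Matrix J I ℂ} (h2 : Vᴴ * V = 1) (w : Matrix I I H) :
    toH H Vᴴ * (toH H V * w * toH H Vᴴ) * toH H (Vᴴ)ᴴ = w := by
  rw [Matrix.conjTranspose_conjTranspose]
  calc _ = (toH H Vᴴ * toH H V) * w * (toH H Vᴴ * toH H V) := by simp only [Matrix.mul_assoc]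
    _ = w := by rw [← toH_mul, h2, toH_one, Matrix.one_mul, Matrix.mul_one]

theorem exists_unitary_of_equiv (e : I ≃ J) :
    ∃ V : Matrix J I ℂ, V * Vᴴ = 1 ∧ Vᴴ * V = 1 := by
  refine ⟨(1 : Matrix I I ℂ).submatrix e.symm id, ?_, ?_⟩
  · rw [Matrix.conjTranspose_submatrix, Matrix.conjTranspose_one,
      Matrix.submatrix_mul _ _ _ id _ Function.bijective_id |>.symm, Matrix.one_mul,
      Matrix.submatrix_one_equiv]
  · rw [Matrix.conjTranspose_submatrix, Matrix.conjTranspose_one,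
      Matrix.submatrix_mul_equiv, Matrix.one_mul, Matrix.submatrix_id_id]

theorem IsSelfIntertwiner.congr {w : Matrix I I H} {V : Matrix J I ℂ} (h2 : Vᴴ * V = 1)
    {T : Matrix J J ℂ} (hT : IsSelfIntertwiner (toH H V * w * toH H Vᴴ) T) :
    IsSelfIntertwiner w (Vᴴ * T * V) := by
  have h3 : toH H Vᴴ * toH H V = 1 := by rw [← toH_mul, h2, toH_one]
  unfold IsSelfIntertwiner at *
  calc toH H (Vᴴ * T * V) * w = toH H Vᴴ * toH H T * toH H V * w * (toH H Vᴴ * toH H V) := by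
        rw [h3, Matrix.mul_one, toH_mul, toH_mul]
    _ = toH H Vᴴ * (toH H T * (toH H V * w * toH H Vᴴ)) * toH H V := by
        simp only [Matrix.mul_assoc]
    _ = (toH H Vᴴ * toH H V) * w * toH H Vᴴ * toH H T * toH H V := by
        rw [hT]; simp only [Matrix.mul_assoc]
    _ = _ := by rw [h3, Matrix.one_mul, toH_mul, toH_mul]; simp only [Matrix.mul_assoc]

/-- Induction on unitary corepresentations: a property which holds for irreducible ones, is
invariant under unitary equivalence and stable under direct sums, always holds. -/
theorem ucorep_induction
    {P : ∀ (I : Type) [Fintype I] [DecidableEq I], Matrix I I H → Prop}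
    (irred : ∀ (n : ℕ) (u : Matrix (Fin n) (Fin n) H), IsIrredUnitaryCorep u → P (Fin n) u)
    (congr : ∀ (I J : Type) [Fintype I] [DecidableEq I] [Fintype J] [DecidableEq J]
      (u : Matrix I I H) (V : Matrix J I ℂ), IsUCorep u → V * Vᴴ = 1 → Vᴴ * V = 1 → P I u →
        P J (toH H V * u * toH H Vᴴ))
    (sum : ∀ (I J : Type) [Fintype I] [DecidableEq I] [Fintype J] [DecidableEq J]
      (u : Matrix I I H) (w : Matrix J J H), IsUCorep u → IsUCorep w → P I u → P J w →
        P (I ⊕ J) (Matrix.fromBlocks u 0 0 w))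
    (I : Type) [Fintype I] [DecidableEq I] (w : Matrix I I H) (hw : IsUCorep w) : P I w := by
  induction hN : Fintype.card I using Nat.strong_induction_on generalizing I with
  | _ N ih =>
  by_cases hirr : ∀ T, IsSelfIntertwiner w T → ∃ c : ℂ, T = c • (1 : Matrix I I ℂ)
  · obtain ⟨V, h1, h2⟩ := exists_unitary_of_equiv (Fintype.equivFin I)
    have hu := hw.congr h1 h2
    have := congr _ I _ Vᴴ hu (by simpa using h2) (by simpa using h1)
      (irred _ _ ⟨hu.isUnitaryCorep, fun T hT => ?_⟩)
    · rwa [conj_conj_cancel h2] at this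
    · obtain ⟨c, hc⟩ := hirr _ (IsSelfIntertwiner.congr h2 hT)
      refine ⟨c, ?_⟩
      calc T = (V * Vᴴ) * T * (V * Vᴴ) := by rw [h1, Matrix.one_mul, Matrix.mul_one]
        _ = V * (Vᴴ * T * V) * Vᴴ := by simp only [Matrix.mul_assoc]
        _ = _ := by rw [hc]; simp [h1]
  · push Not at hirr
    obtain ⟨T, hT, hns⟩ := hirr
    obtain ⟨S, hS, hSw, hSns⟩ := exists_hermitian_selfIntertwiner hw hT (by simpa using hns)
    set U : Matrix I I ℂ := (hS.eigenvectorUnitary : Matrix I I ℂ) with hU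
    have hU1 : U * Uᴴ = 1 := eigenvectorUnitary_mul_conjTranspose hS
    have hU2 : Uᴴ * U = 1 := eigenvectorUnitary_conjTranspose_mul hS
    have hSU : S = U * Matrix.diagonal (fun i => ((hS.eigenvalues i : ℝ) : ℂ)) * Uᴴ :=
      isHermitian_eq_conj_diagonal hS
    set d := hS.eigenvalues
    have hd : ∃ i j, d i ≠ d j := by
      by_contra! hcon
      refine hSns ?_
      rcases isEmpty_or_nonempty I with hI | ⟨⟨i0⟩⟩
      · exact ⟨0, Subsingleton.elim _ _⟩
      · refine ⟨d i0, ?_⟩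
        have : Matrix.diagonal (fun i => ((d i : ℝ) : ℂ)) = ((d i0 : ℝ) : ℂ) • 1 := by
          rw [← Matrix.diagonal_one, ← Matrix.diagonal_smul]
          congr 1
          ext i
          simp [hcon i i0]
        rw [hSU, this]
        simp [hU1]
    obtain ⟨i0, i1, h01⟩ := hd
    have hw' : toH H Uᴴ * w * toH H U = toH H Uᴴ * w * toH H (Uᴴ)ᴴ := by
      rw [Matrix.conjTranspose_conjTranspose]
    -- In an eigenbasis of S, w commutes with a diagonal matrix, so its entries between distinct
    -- eigenvalues vanish. Separating one eigenvalue from the others then splits w into two smaller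
    -- blocks.
    have hdiag : ∀ i j, d i ≠ d j → (toH H Uᴴ * w * toH H U) i j = 0 := by
      intro i j hij
      have h1 : IsSelfIntertwiner (toH H Uᴴ * w * toH H U)
          (Matrix.diagonal (fun i => ((d i : ℝ) : ℂ))) := by
        have h2 : IsSelfIntertwiner (toH H (Uᴴ)ᴴ * (toH H Uᴴ * w * toH H (Uᴴ)ᴴ) *
            toH H ((Uᴴ)ᴴ)ᴴ) S := by
          rwa [conj_conj_cancel (by simpa using hU1)]
        rw [← hw'] at h2
        have h3 := IsSelfIntertwiner.congr (by simpa using hU2) h2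
        rw [hSU] at h3
        have h4 : ((Uᴴ)ᴴ)ᴴ * (U * Matrix.diagonal (fun i => ((d i : ℝ) : ℂ)) * Uᴴ) * (Uᴴ)ᴴ =
            Matrix.diagonal (fun i => ((d i : ℝ) : ℂ)) := by
          simp only [Matrix.conjTranspose_conjTranspose]
          calc _ = (Uᴴ * U) * Matrix.diagonal (fun i => ((d i : ℝ) : ℂ)) * (Uᴴ * U) := by
                simp only [Matrix.mul_assoc]
            _ = _ := by rw [hU2, Matrix.one_mul, Matrix.mul_one]
        rwa [h4] at h3
      have h2 := congrFun (congrFun h1 i) j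
      rw [toH_mul_apply, mul_toH_apply] at h2
      simp only [Matrix.diagonal_apply, ite_smul, zero_smul, Finset.sum_ite_eq,
        Finset.sum_ite_eq', Finset.mem_univ, if_true] at h2
      rw [← sub_eq_zero, ← sub_smul, smul_eq_zero, sub_eq_zero] at h2
      exact h2.resolve_left fun h => hij (by exact_mod_cast h)
    let e := Equiv.sumCompl (fun i => d i = d i0)
    set V : Matrix ({i // d i = d i0} ⊕ {i // ¬ d i = d i0}) I ℂ := Uᴴ.submatrix e id with hV
    have hV1 : V * Vᴴ = 1 := by
      rw [hV, Matrix.conjTranspose_submatrix,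
        (Matrix.submatrix_mul _ _ _ id _ Function.bijective_id).symm,
        Matrix.conjTranspose_conjTranspose, hU2, Matrix.submatrix_one_equiv]
    have hV2 : Vᴴ * V = 1 := by
      rw [hV, Matrix.conjTranspose_submatrix, Matrix.submatrix_mul_equiv,
        Matrix.conjTranspose_conjTranspose, hU1, Matrix.submatrix_id_id]
    have hVw : toH H V * w * toH H Vᴴ = (toH H Uᴴ * w * toH H U).submatrix e e := by
      ext i j
      simp [hV, Matrix.mul_apply, toH_apply]
    set w' := toH H Uᴴ * w * toH H U
    have hblock : toH H V * w * toH H Vᴴ = Matrix.fromBlocks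
        (w'.submatrix (fun i => e (Sum.inl i)) (fun i => e (Sum.inl i))) 0 0
        (w'.submatrix (fun i => e (Sum.inr i)) (fun i => e (Sum.inr i))) := by
      rw [hVw]
      ext (i | i) (j | j)
      · rfl
      · exact hdiag _ _ fun h => j.2 (h.symm.trans i.2)
      · exact hdiag _ _ fun h => i.2 (h.trans j.2)
      · rfl
    have hu := hw.congr hV1 hV2
    rw [hblock] at hu
    obtain ⟨hu1, hu2⟩ := isUCorep_of_fromBlocks hu
    have hc1 : Fintype.card {i // d i = d i0} < N :=
      hN ▸ Fintype.card_subtype_lt (x := i1) (Ne.symm h01)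
    have hc2 : Fintype.card {i // ¬ d i = d i0} < N :=
      hN ▸ Fintype.card_subtype_lt (x := i0) (by simp)
    have hP := sum _ _ _ _ hu1 hu2 (ih _ hc1 _ _ hu1 rfl) (ih _ hc2 _ _ hu2 rfl)
    rw [← hblock] at hP
    have := congr _ I _ Vᴴ (hw.congr hV1 hV2) (by simpa using hV2) (by simpa using hV1) hP
    rwa [conj_conj_cancel hV2] at this

end Decomposition

/-! ### The canonical intertwiner of a general unitary corepresentation. -/

section CanonicalIntertwiner

variable {H : Type*} [Ring H] [HopfAlgebra ℂ H]
variable {I J : Type*} [Fintype I] [DecidableEq I] [Fintype J] [DecidableEq J]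

theorem posDef_mul_inv {F : Matrix I I ℂ} (hF : F.PosDef) : F * F⁻¹ = 1 :=
  Matrix.mul_nonsing_inv _ ((Matrix.isUnit_iff_isUnit_det _).1 hF.isUnit)

theorem posDef_inv_mul {F : Matrix I I ℂ} (hF : F.PosDef) : F⁻¹ * F = 1 :=
  Matrix.nonsing_inv_mul _ ((Matrix.isUnit_iff_isUnit_det _).1 hF.isUnit)

/-- The canonical intertwiner between a unitary corepresentation `w`, not necessarily irreducible,
and `(id ⊗ S²) w`. -/
structure IsCanonicalIntertwiner (w : Matrix I I H) (F : Matrix I I ℂ) : Prop where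
  posDef : F.PosDef
  intertwines : toH H F * w = w.map (antipodeSq H) * toH H F
  trace_eq : ∀ T, IsSelfIntertwiner w T → (T * F).trace = (T * F⁻¹).trace

theorem inv_intertwines {w w' : Matrix I I H} {F : Matrix I I ℂ} (hF : F.PosDef)
    (h : toH H F * w = w' * toH H F) : toH H F⁻¹ * w' = w * toH H F⁻¹ := by
  have h1 : toH H F * toH H F⁻¹ = 1 := by rw [← toH_mul, posDef_mul_inv hF, toH_one]
  have h2 : toH H F⁻¹ * toH H F = 1 := by rw [← toH_mul, posDef_inv_mul hF, toH_one]
  calc toH H F⁻¹ * w' = toH H F⁻¹ * w' * (toH H F * toH H F⁻¹) := by rw [h1, Matrix.mul_one]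
    _ = toH H F⁻¹ * (w' * toH H F) * toH H F⁻¹ := by simp only [Matrix.mul_assoc]
    _ = (toH H F⁻¹ * toH H F) * w * toH H F⁻¹ := by rw [← h]; simp only [Matrix.mul_assoc]
    _ = _ := by rw [h2, Matrix.one_mul]

/-- Since S² is linear, T also commutes with S²(w); the product is the composite w → S²(w) → S²(w) →
w. -/
theorem IsSelfIntertwiner.inv_mul_mul {w : Matrix I I H} {F F' T : Matrix I I ℂ}
    (hF : F.PosDef) (h : toH H F * w = w.map (antipodeSq H) * toH H F)
    (h' : toH H F' * w = w.map (antipodeSq H) * toH H F') (hT : IsSelfIntertwiner w T) :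
    IsSelfIntertwiner w (F⁻¹ * T * F') := by
  have h1 : toH H T * w.map (antipodeSq H) = w.map (antipodeSq H) * toH H T := by
    rw [← mapH_toH_mul, hT, mapH_mul_toH]
  unfold IsSelfIntertwiner
  rw [toH_mul, toH_mul, Matrix.mul_assoc, h', ← Matrix.mul_assoc, Matrix.mul_assoc (toH H F⁻¹), h1,
    ← Matrix.mul_assoc, inv_intertwines hF h]
  simp only [Matrix.mul_assoc]

variable [StarRing H] [StarModule ℂ H]

/-- The canonical intertwiner is central relative to the self-intertwiners. -/
theorem IsCanonicalIntertwiner.commute {w : Matrix I I H} (hw : IsUCorep w) {F : Matrix I I ℂ}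
    (hF : IsCanonicalIntertwiner w F) {S : Matrix I I ℂ} (hS : IsSelfIntertwiner w S) :
    F * S = S * F := by
  have hFi := posDef_mul_inv hF.posDef
  have hiF := posDef_inv_mul hF.posDef
  have hFh : Fᴴ = F := hF.posDef.isHermitian
  have hFih : (F⁻¹)ᴴ = F⁻¹ := hF.posDef.inv.isHermitian
  have h1 : IsSelfIntertwiner w (F⁻¹ * S * F) :=
    hS.inv_mul_mul hF.posDef hF.intertwines hF.intertwines
  have h2 : IsSelfIntertwiner w (F * S * F⁻¹) := by
    have := ((hS.conjTranspose hw).inv_mul_mul hF.posDef hF.intertwines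
      hF.intertwines).conjTranspose hw
    simpa [Matrix.conjTranspose_mul, hFh, hFih, Matrix.mul_assoc] using this
  -- The normalisation, applied on both sides, gives Tr(DTF) = 0 for all self-intertwiners T. The
  -- choice T = D* yields D = 0, that is, S commutes with F², hence with F.
  set D := F⁻¹ * S * F - F * S * F⁻¹ with hD
  have hDw : IsSelfIntertwiner w D := h1.sub h2
  have h3 : ∀ T, IsSelfIntertwiner w T → (D * T * F).trace = 0 := fun T hT => by
    have e1 : (F⁻¹ * S * F * T * F).trace = (T * S * F).trace := by
      rw [Matrix.mul_assoc F⁻¹, Matrix.mul_assoc F⁻¹, Matrix.mul_assoc F⁻¹, Matrix.trace_mul_comm]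
      calc _ = (S * F * T * (F * F⁻¹)).trace := by simp only [Matrix.mul_assoc]
        _ = (S * (F * T)).trace := by rw [hFi, Matrix.mul_one, Matrix.mul_assoc]
        _ = (F * (T * S)).trace := by rw [Matrix.trace_mul_comm, Matrix.mul_assoc]
        _ = _ := Matrix.trace_mul_comm _ _
    have e2 : (F * S * F⁻¹ * T * F).trace = (T * S * F).trace := by
      rw [hF.trace_eq _ (h2.mul hT), hF.trace_eq _ (hT.mul hS)]
      calc (F * S * F⁻¹ * T * F⁻¹).trace = (F * (S * F⁻¹ * T * F⁻¹)).trace := by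
            simp only [Matrix.mul_assoc]
        _ = (S * F⁻¹ * T * (F⁻¹ * F)).trace := by
            rw [Matrix.trace_mul_comm]; simp only [Matrix.mul_assoc]
        _ = ((S * F⁻¹) * T).trace := by rw [hiF, Matrix.mul_one]
        _ = _ := by rw [Matrix.trace_mul_comm, Matrix.mul_assoc]
    rw [hD, Matrix.sub_mul, Matrix.sub_mul, Matrix.trace_sub, e1, e2, sub_self]
  have h4 : D = 0 := by
    refine eq_zero_of_trace_eq_zero hF.posDef ?_
    rw [Matrix.trace_mul_comm, ← Matrix.mul_assoc]
    exact h3 _ (hDw.conjTranspose hw)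
  have h5 : F⁻¹ * S * F = F * S * F⁻¹ := sub_eq_zero.1 h4
  refine mul_eq_mul_of_sq hF.posDef hF.posDef ?_
  calc F ^ 2 * S = F * (F * S * F⁻¹) * F := by
        rw [pow_two]; simp only [Matrix.mul_assoc]; rw [hiF, Matrix.mul_one]
    _ = F * F⁻¹ * S * F * F := by rw [← h5]; simp only [Matrix.mul_assoc]
    _ = _ := by rw [hFi, Matrix.one_mul, pow_two, Matrix.mul_assoc]

/-- X = F⁻¹F' is a self-intertwiner, so F commutes with it and hence with F'. The two normalisations
give Tr(T(X − X⁻¹)F⁻¹) = 0 for all self-intertwiners T, so X = X⁻¹. Thus F² = F'², and positive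
square roots are unique. -/
theorem IsCanonicalIntertwiner.unique {w : Matrix I I H} (hw : IsUCorep w) {F F' : Matrix I I ℂ}
    (hF : IsCanonicalIntertwiner w F) (hF' : IsCanonicalIntertwiner w F') : F = F' := by
  have hFi := posDef_mul_inv hF.posDef
  have hiF := posDef_inv_mul hF.posDef
  have hFi' := posDef_mul_inv hF'.posDef
  have hiF' := posDef_inv_mul hF'.posDef
  have hX : IsSelfIntertwiner w (F⁻¹ * F') := by
    simpa using (isSelfIntertwiner_one w).inv_mul_mul hF.posDef hF.intertwines hF'.intertwines
  have hY : IsSelfIntertwiner w (F'⁻¹ * F) := by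
    simpa using (isSelfIntertwiner_one w).inv_mul_mul hF'.posDef hF'.intertwines hF.intertwines
  have hc : F * F' = F' * F := by
    have h1 := hF.commute hw hX
    calc F * F' = F * (F * (F⁻¹ * F')) := by rw [← Matrix.mul_assoc F F⁻¹, hFi, Matrix.one_mul]
      _ = F * F⁻¹ * F' * F := by rw [h1]; simp only [Matrix.mul_assoc]
      _ = _ := by rw [hFi, Matrix.one_mul]
  set D := F⁻¹ * F' - F'⁻¹ * F with hD
  have hDw : IsSelfIntertwiner w D := hX.sub hY
  have hFX : F * (F⁻¹ * F') = F' := by rw [← Matrix.mul_assoc, hFi, Matrix.one_mul]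
  have hXF : (F⁻¹ * F') * F = F' := by rw [Matrix.mul_assoc, ← hc, ← Matrix.mul_assoc, hiF, Matrix.one_mul]
  have hYF : (F'⁻¹ * F) * F⁻¹ = F'⁻¹ := by rw [Matrix.mul_assoc, hFi, Matrix.mul_one]
  have h3 : ∀ T, IsSelfIntertwiner w T → (T * D * F⁻¹).trace = 0 := fun T hT => by
    have e1 : (T * (F⁻¹ * F') * F⁻¹).trace = (T * F').trace := by
      rw [← hF.trace_eq _ (hT.mul hX), Matrix.mul_assoc, hXF]
    have e2 : (T * (F'⁻¹ * F) * F⁻¹).trace = (T * F').trace := by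
      rw [Matrix.mul_assoc, hYF, hF'.trace_eq _ hT]
    rw [hD, Matrix.mul_sub, Matrix.sub_mul, Matrix.trace_sub, e1, e2, sub_self]
  have h4 : D = 0 := by
    rw [← Matrix.conjTranspose_eq_zero]
    refine eq_zero_of_trace_eq_zero hF.posDef.inv ?_
    rw [Matrix.conjTranspose_conjTranspose, Matrix.trace_mul_comm, ← Matrix.mul_assoc]
    exact h3 _ (hDw.conjTranspose hw)
  have h5 : F⁻¹ * F' = F'⁻¹ * F := sub_eq_zero.1 h4
  have h6 := mul_eq_mul_of_sq hF.posDef hF'.posDef (T := 1) (by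
    rw [Matrix.mul_one, Matrix.one_mul]
    calc F ^ 2 = F * (F' * (F'⁻¹ * F)) := by
          rw [← Matrix.mul_assoc F' F'⁻¹, hFi', Matrix.one_mul, pow_two]
      _ = F' * F * (F⁻¹ * F') := by rw [← h5, ← Matrix.mul_assoc, hc]
      _ = F' ^ 2 := by rw [Matrix.mul_assoc, hFX, pow_two])
  simpa using h6

theorem trace_fromBlocks (A : Matrix I I ℂ) (B : Matrix I J ℂ) (C : Matrix J I ℂ)
    (D : Matrix J J ℂ) : (Matrix.fromBlocks A B C D).trace = A.trace + D.trace := by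
  simp [Matrix.trace, Matrix.diag]

theorem inv_fromBlocks_diagonal {F : Matrix I I ℂ} {G : Matrix J J ℂ} (hF : F.PosDef)
    (hG : G.PosDef) :
    (Matrix.fromBlocks F 0 0 G)⁻¹ = Matrix.fromBlocks F⁻¹ 0 0 G⁻¹ := by
  refine Matrix.inv_eq_right_inv ?_
  simp [Matrix.fromBlocks_multiply, posDef_mul_inv hF, posDef_mul_inv hG]

theorem posDef_fromBlocks_diagonal {F : Matrix I I ℂ} {G : Matrix J J ℂ} (hF : F.PosDef)
    (hG : G.PosDef) : (Matrix.fromBlocks F 0 0 G).PosDef := by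
  have := hF.isUnit.invertible
  have h1 : (Matrix.fromBlocks F 0 0 G).PosSemidef := by
    have := (Matrix.PosDef.fromBlocks₁₁ (0 : Matrix I J ℂ) G hF).2 (by simpa using hG.posSemidef)
    simpa using this
  refine h1.posDef_iff_isUnit.2 (IsUnit.of_mul_eq_one (Matrix.fromBlocks F⁻¹ 0 0 G⁻¹) ?_)
  simp [Matrix.fromBlocks_multiply, posDef_mul_inv hF, posDef_mul_inv hG]

theorem IsCanonicalIntertwiner.fromBlocks {u : Matrix I I H} {w : Matrix J J H}
    {F : Matrix I I ℂ} {G : Matrix J J ℂ} (hF : IsCanonicalIntertwiner u F)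
    (hG : IsCanonicalIntertwiner w G) :
    IsCanonicalIntertwiner (Matrix.fromBlocks u 0 0 w) (Matrix.fromBlocks F 0 0 G) := by
  have hto : ∀ (A : Matrix I I ℂ) (B : Matrix I J ℂ) (C : Matrix J I ℂ) (D : Matrix J J ℂ),
      toH H (Matrix.fromBlocks A B C D) =
        Matrix.fromBlocks (toH H A) (toH H B) (toH H C) (toH H D) := fun A B C D =>
    Matrix.fromBlocks_map _ _ _ _ _
  have hto1 : toH H (0 : Matrix I J ℂ) = 0 := by ext; simp [toH_apply]
  have hto2 : toH H (0 : Matrix J I ℂ) = 0 := by ext; simp [toH_apply]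
  refine ⟨posDef_fromBlocks_diagonal hF.posDef hG.posDef, ?_, ?_⟩
  · rw [hto, hto1, hto2, Matrix.fromBlocks_map]
    simp [Matrix.fromBlocks_multiply, hF.intertwines, hG.intertwines]
  · intro T hT
    have h1 := Matrix.fromBlocks_toBlocks T
    rw [← h1] at hT ⊢
    rw [IsSelfIntertwiner, hto, Matrix.fromBlocks_multiply, Matrix.fromBlocks_multiply,
      Matrix.fromBlocks_inj] at hT
    have h2 := hF.trace_eq T.toBlocks₁₁ (by simpa [IsSelfIntertwiner] using hT.1)
    have h3 := hG.trace_eq T.toBlocks₂₂ (by simpa [IsSelfIntertwiner] using hT.2.2.2)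
    rw [inv_fromBlocks_diagonal hF.posDef hG.posDef]
    simp [Matrix.fromBlocks_multiply, trace_fromBlocks, h2, h3]

theorem posDef_unitary_conj {F : Matrix I I ℂ} (hF : F.PosDef) {V : Matrix J I ℂ}
    (h1 : V * Vᴴ = 1) : (V * F * Vᴴ).PosDef := by
  refine hF.mul_mul_conjTranspose_same fun x y hxy => ?_
  have h2 := congrArg (fun z => z ᵥ* Vᴴ) hxy
  simpa [Matrix.vecMul_vecMul, h1] using h2

theorem inv_unitary_conj {F : Matrix I I ℂ} (hF : F.PosDef) {V : Matrix J I ℂ}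
    (h1 : V * Vᴴ = 1) (h2 : Vᴴ * V = 1) : (V * F * Vᴴ)⁻¹ = V * F⁻¹ * Vᴴ := by
  refine Matrix.inv_eq_right_inv ?_
  calc V * F * Vᴴ * (V * F⁻¹ * Vᴴ) = V * F * (Vᴴ * V) * F⁻¹ * Vᴴ := by
        simp only [Matrix.mul_assoc]
    _ = 1 := by rw [h2, Matrix.mul_one, Matrix.mul_assoc V, posDef_mul_inv hF, Matrix.mul_one, h1]

theorem IsCanonicalIntertwiner.congr {u : Matrix I I H} {F : Matrix I I ℂ}
    (hF : IsCanonicalIntertwiner u F) {V : Matrix J I ℂ} (h1 : V * Vᴴ = 1) (h2 : Vᴴ * V = 1) :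
    IsCanonicalIntertwiner (toH H V * u * toH H Vᴴ) (V * F * Vᴴ) := by
  have h3 : toH H Vᴴ * toH H V = 1 := by rw [← toH_mul, h2, toH_one]
  refine ⟨posDef_unitary_conj hF.posDef h1, ?_, fun T hT => ?_⟩
  · rw [mapH_mul_toH, mapH_toH_mul, toH_mul, toH_mul]
    calc _ = toH H V * toH H F * (toH H Vᴴ * toH H V) * u * toH H Vᴴ := by
          simp only [Matrix.mul_assoc]
      _ = toH H V * (toH H F * u) * toH H Vᴴ := by
          rw [h3, Matrix.mul_one]; simp only [Matrix.mul_assoc]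
      _ = toH H V * u.map (antipodeSq H) * (toH H Vᴴ * toH H V) * toH H F * toH H Vᴴ := by
          rw [hF.intertwines, h3, Matrix.mul_one]; simp only [Matrix.mul_assoc]
      _ = _ := by simp only [Matrix.mul_assoc]
  · rw [inv_unitary_conj hF.posDef h1 h2]
    have h4 := hF.trace_eq _ (hT.congr h2)
    have h5 : ∀ G : Matrix I I ℂ, (T * (V * G * Vᴴ)).trace = (Vᴴ * T * V * G).trace := fun G => by
      rw [← Matrix.mul_assoc, Matrix.trace_mul_comm]
      simp only [Matrix.mul_assoc]
    rw [h5, h5, h4]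

variable [IsCQGAlgebra H]

theorem exists_canonicalIntertwiner_of_irred {n : ℕ} {u : Matrix (Fin n) (Fin n) H}
    (hu : IsIrredUnitaryCorep u) : ∃ F : Matrix (Fin n) (Fin n) ℂ, IsCanonicalIntertwiner u F := by
  obtain ⟨F, hF, hFu⟩ := hu.toIsUnitaryCorep.isUCorep.exists_antipodeSq_intertwiner
  -- Size zero counts as irreducible here; its traces vanish and cannot be used for rescaling.
  rcases isEmpty_or_nonempty (Fin n) with hn | hn
  · exact ⟨F, hF, hFu, fun T _ => by simp [Matrix.trace]⟩
  have ht := hF.trace_pos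
  have hti := hF.inv.trace_pos
  set a := F.trace with ha
  set b := (F⁻¹).trace with hb
  obtain ⟨ha1, ha2⟩ := Complex.pos_iff.1 ht
  obtain ⟨hb1, hb2⟩ := Complex.pos_iff.1 hti
  have ha3 : a = (a.re : ℂ) := Complex.ext rfl ha2.symm
  have hb3 : b = (b.re : ℂ) := Complex.ext rfl hb2.symm
  -- The scalar solving c Tr(F) = c⁻¹ Tr(F⁻¹). Self-intertwiners being scalars, this single equality
  -- is the whole normalisation.
  set c : ℝ := Real.sqrt (b.re / a.re) with hc
  have hc0 : 0 < c := Real.sqrt_pos.2 (div_pos hb1 ha1)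
  have hcC : (c : ℂ) ≠ 0 := by exact_mod_cast hc0.ne'
  have hc2 : (c : ℂ) * a = (c : ℂ)⁻¹ * b := by
    have h1 : c * c = b.re / a.re := Real.mul_self_sqrt (div_pos hb1 ha1).le
    have h2 : c * c * a.re = b.re := by rw [h1]; field_simp
    rw [eq_inv_mul_iff_mul_eq₀ hcC, ha3, hb3, ← mul_assoc]
    exact_mod_cast h2
  have hinv : ((c : ℂ) • F)⁻¹ = (c : ℂ)⁻¹ • F⁻¹ := by
    refine Matrix.inv_eq_right_inv ?_
    rw [Matrix.smul_mul, Matrix.mul_smul, smul_smul, mul_inv_cancel₀ hcC, one_smul,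
      posDef_mul_inv hF]
  refine ⟨(c : ℂ) • F, hF.smul (by exact_mod_cast hc0), ?_, fun T hT => ?_⟩
  · rw [toH_smul, Matrix.smul_mul, Matrix.mul_smul, hFu]
  · obtain ⟨t, rfl⟩ := hu.irreducible T hT
    rw [hinv]
    simp only [Matrix.smul_mul, Matrix.one_mul, Matrix.trace_smul, ← ha, ← hb, smul_eq_mul, hc2]

theorem IsUCorep.exists_canonicalIntertwiner {I : Type} [Fintype I] [DecidableEq I]
    {w : Matrix I I H} (hw : IsUCorep w) : ∃ F : Matrix I I ℂ, IsCanonicalIntertwiner w F := by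
  refine ucorep_induction (P := fun I _ _ w => ∃ F : Matrix I I ℂ, IsCanonicalIntertwiner w F)
    ?_ ?_ ?_ I w hw
  · exact fun n u hu => exists_canonicalIntertwiner_of_irred hu
  · rintro I J _ _ _ _ u V - h1 h2 ⟨F, hF⟩
    exact ⟨_, hF.congr h1 h2⟩
  · rintro I J _ _ _ _ u w - - ⟨F, hF⟩ ⟨G, hG⟩
    exact ⟨_, hF.fromBlocks hG⟩

end CanonicalIntertwiner

/-! ### Canonical intertwiners of tensor products, by partial traces. -/

section Tensor

open scoped Kronecker

variable {H : Type*} [Ring H] [HopfAlgebra ℂ H]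
variable {I J : Type*} [Fintype I] [DecidableEq I] [Fintype J] [DecidableEq J]

/-- Over the noncommutative `H` transposes do not reverse products, but here the entries of P stay
to the left of those of Q, so the sum still contracts to PQ = 1. -/
theorem trace_transpose_mul_toH_mul_transpose {P Q : Matrix I I H} (h : P * Q = 1)
    (X : Matrix I I ℂ) : (Pᵀ * toH H X * Qᵀ).trace = algebraMap ℂ H X.trace := by
  have h1 : ∀ b c, ∑ a, P b a * Q a c = if b = c then 1 else 0 := fun b c => by
    have := congrFun (congrFun h b) c
    simpa [Matrix.mul_apply, Matrix.one_apply] using this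
  calc (Pᵀ * toH H X * Qᵀ).trace = ∑ a, ∑ c, ∑ b, X b c • (P b a * Q a c) := by
        simp only [Matrix.trace, Matrix.diag, Matrix.mul_apply (M := Pᵀ * toH H X),
          mul_toH_apply, Finset.sum_mul, smul_mul_assoc, Matrix.transpose_apply]
    _ = ∑ c, ∑ b, X b c • ∑ a, P b a * Q a c := by
        rw [Finset.sum_comm]
        refine Finset.sum_congr rfl fun c _ => ?_
        rw [Finset.sum_comm]
        simp only [Finset.smul_sum]
    _ = _ := by
        simp only [h1, smul_ite, smul_zero, Finset.sum_ite_eq', Finset.mem_univ, if_true,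
          Matrix.trace, Matrix.diag, map_sum, Algebra.algebraMap_eq_smul_one]

theorem trace_toH_mul_comm (X : Matrix I I ℂ) (M : Matrix I I H) :
    (toH H X * M).trace = (M * toH H X).trace := by
  simp only [Matrix.trace, Matrix.diag, toH_mul_apply, mul_toH_apply]
  exact Finset.sum_comm

variable [StarRing H]

theorem IsUCorep.map_antipodeSq {u : Matrix I I H} (hu : IsUCorep u) :
    u.map (antipodeSq H) = ((u.map star).map (HopfAlgebra.antipode ℂ))ᵀ := by
  ext i j
  have h : HopfAlgebra.antipode ℂ (u i j) = star (u j i) := congrFun (congrFun hu.antipode i) j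
  simp [antipodeSq, h]

variable [StarModule ℂ H] [IsCQGAlgebra H]

/-- Moving G across v turns v into S²(v), the transpose of the antipode of the conjugate of v. This
cancels against v*, the transpose of that conjugate. -/
theorem trace_right_conj {v : Matrix J J H} (hv : IsUCorep v) {G : Matrix J J ℂ}
    (hG : toH H G * v = v.map (antipodeSq H) * toH H G) (T : Matrix J J ℂ) :
    (toH H G * (v * toH H T * vᴴ)).trace = algebraMap ℂ H (G * T).trace := by
  rw [← Matrix.mul_assoc, ← Matrix.mul_assoc, hG, Matrix.mul_assoc (v.map _), ← toH_mul,
    hv.map_antipodeSq]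
  exact trace_transpose_mul_toH_mul_transpose hv.toIsCorep.conj.antipode_mul_self _

theorem trace_left_conj {u : Matrix I I H} (hu : IsUCorep u) {F : Matrix I I ℂ}
    (hF : toH H F * u.map (antipodeSq H) = u * toH H F) (T : Matrix I I ℂ) :
    (toH H F * (uᴴ * toH H T * u)).trace = algebraMap ℂ H (F * T).trace := by
  rw [trace_toH_mul_comm, Matrix.mul_assoc, ← hF, ← Matrix.mul_assoc, Matrix.mul_assoc uᴴ,
    ← toH_mul, hu.map_antipodeSq, Matrix.trace_mul_comm F]
  exact trace_transpose_mul_toH_mul_transpose hu.toIsCorep.conj.self_mul_antipode _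

/-- Writing the intertwining relation in blocks and moving v to one side leaves conjugates by v,
which the trace weighted by G does not see. -/
theorem IsSelfIntertwiner.partial_trace_right {u : Matrix I I H} {v : Matrix J J H}
    (hv : IsUCorep v) {G : Matrix J J ℂ}
    (hG : toH H G * v = v.map (antipodeSq H) * toH H G) {T : Matrix (I × J) (I × J) ℂ}
    (hT : IsSelfIntertwiner (tensorMat u v) T) :
    IsSelfIntertwiner u (Matrix.of fun i j =>
      (G * Matrix.of fun k l => T (i, k) (j, l)).trace) := by
  set B : I → I → Matrix J J ℂ := fun i j => Matrix.of fun k l => T (i, k) (j, l) with hB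
  have h1 : ∀ i m, ∑ j, u j m • (toH H (B i j) * v) = ∑ j, u i j • (v * toH H (B j m)) := by
    intro i m
    ext k n
    have h := congrFun (congrFun hT (i, k)) (m, n)
    rw [toH_mul_apply, mul_toH_apply, Fintype.sum_prod_type, Fintype.sum_prod_type] at h
    simp only [Matrix.sum_apply, Matrix.smul_apply, smul_eq_mul, toH_mul_apply, mul_toH_apply,
      Finset.mul_sum, mul_smul_comm]
    exact h
  have h2 : ∀ i m, ∑ j, u j m • toH H (B i j) = ∑ j, u i j • (v * toH H (B j m) * vᴴ) := by
    intro i m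
    have := congrArg (· * vᴴ) (h1 i m)
    simpa only [Finset.sum_mul, Matrix.smul_mul, Matrix.mul_assoc, hv.mul_conjTranspose_self,
      Matrix.mul_one] using this
  have h3 : ∀ (h : H) (M : Matrix J J H), (toH H G * (h • M)).trace = h * (toH H G * M).trace := by
    intro h M
    simp only [Matrix.trace, Matrix.diag, toH_mul_apply, Matrix.smul_apply, smul_eq_mul,
      Finset.mul_sum, mul_smul_comm]
  ext i m
  have h4 := congrArg (fun M => (toH H G * M).trace) (h2 i m)
  simp only [Finset.mul_sum, Matrix.trace_sum, h3, trace_right_conj hv hG] at h4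
  simp only [Matrix.mul_apply, toH_apply, Matrix.of_apply]
  rw [← h4]
  refine Finset.sum_congr rfl fun j _ => ?_
  rw [← toH_mul, Algebra.commutes]
  congr 1
  simp [Matrix.trace, toH_apply, hB]

theorem IsSelfIntertwiner.partial_trace_left {u : Matrix I I H} {v : Matrix J J H}
    (hu : IsUCorep u) {F : Matrix I I ℂ}
    (hF : toH H F * u.map (antipodeSq H) = u * toH H F) {T : Matrix (I × J) (I × J) ℂ}
    (hT : IsSelfIntertwiner (tensorMat u v) T) :
    IsSelfIntertwiner v (Matrix.of fun k l =>
      (F * Matrix.of fun i j => T (i, k) (j, l)).trace) := by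
  set B : J → J → Matrix I I ℂ := fun k l => Matrix.of fun i j => T (i, k) (j, l) with hB
  have h3 : ∀ (Y : Matrix I I H) (h : H) (M : Matrix I I H),
      Y * M.map (· * h) = (Y * M).map (· * h) := by
    intro Y h M
    ext i j
    simp [Matrix.mul_apply, Finset.sum_mul, mul_assoc]
  have h3' : ∀ (h : H) (M : Matrix I I H), (M.map (· * h)).trace = M.trace * h := by
    intro h M
    simp [Matrix.trace, Finset.sum_mul]
  have h1 : ∀ k n, ∑ l, (toH H (B k l) * u).map (· * v l n) =
      ∑ l, (u * toH H (B l n)).map (· * v k l) := by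
    intro k n
    ext i m
    have h := congrFun (congrFun hT (i, k)) (m, n)
    rw [toH_mul_apply, mul_toH_apply, Fintype.sum_prod_type, Fintype.sum_prod_type,
      Finset.sum_comm] at h
    conv_rhs at h => rw [Finset.sum_comm]
    simp only [Matrix.sum_apply, Matrix.map_apply, toH_mul_apply, mul_toH_apply,
      Finset.sum_mul, smul_mul_assoc]
    exact h
  have h2 : ∀ k n, ∑ l, (uᴴ * toH H (B k l) * u).map (· * v l n) =
      ∑ l, (toH H (B l n)).map (· * v k l) := by
    intro k n
    have := congrArg (uᴴ * ·) (h1 k n)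
    simpa only [Finset.mul_sum, h3, ← Matrix.mul_assoc, hu.conjTranspose_mul_self,
      Matrix.one_mul] using this
  ext k n
  have h4 := congrArg (fun M => (toH H F * M).trace) (h2 k n)
  simp only [Finset.mul_sum, Matrix.trace_sum, h3, h3', trace_left_conj hu hF] at h4
  simp only [Matrix.mul_apply, toH_apply, Matrix.of_apply]
  rw [h4]
  refine Finset.sum_congr rfl fun j _ => ?_
  rw [← toH_mul, ← Algebra.commutes]
  congr 1
  simp [Matrix.trace, toH_apply, hB]

theorem IsCanonicalIntertwiner.tensor {u : Matrix I I H} {v : Matrix J J H}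
    (hu : IsUCorep u) (hv : IsUCorep v) {F : Matrix I I ℂ} {G : Matrix J J ℂ}
    (hF : IsCanonicalIntertwiner u F) (hG : IsCanonicalIntertwiner v G) :
    IsCanonicalIntertwiner (tensorMat u v) (F ⊗ₖ G) := by
  refine ⟨hF.posDef.kronecker hG.posDef, ?_, fun T hT => ?_⟩
  · ext ⟨i, k⟩ ⟨m, n⟩
    have h1 := congrFun (congrFun hF.intertwines i) m
    have h2 := congrFun (congrFun hG.intertwines k) n
    rw [toH_mul_apply, mul_toH_apply] at h1 h2 ⊢
    have h3 := congrArg₂ (· * ·) h1 h2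
    simp only [Finset.sum_mul_sum, smul_mul_smul_comm] at h3
    simpa only [Fintype.sum_prod_type, Matrix.kroneckerMap_apply, tensorMat, Matrix.of_apply,
      Matrix.map_apply, antipodeSq, LinearMap.comp_apply,
      HopfAlgebra.antipode_mul_antidistrib] using h3
  · have key : ∀ (X : Matrix I I ℂ) (Y : Matrix J J ℂ),
        (T * X ⊗ₖ Y).trace = ((Matrix.of fun i j =>
          (Y * Matrix.of fun k l => T (i, k) (j, l)).trace) * X).trace := by
      intro X Y
      simp only [Matrix.trace, Matrix.diag, Matrix.mul_apply, Fintype.sum_prod_type,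
        Matrix.kroneckerMap_apply, Matrix.of_apply, Finset.sum_mul]
      refine Finset.sum_congr rfl fun i _ => ?_
      rw [Finset.sum_comm]
      refine Finset.sum_congr rfl fun j _ => ?_
      rw [Finset.sum_comm]
      refine Finset.sum_congr rfl fun k _ => Finset.sum_congr rfl fun l _ => ?_
      ring
    have key' : ∀ (X : Matrix I I ℂ) (Y : Matrix J J ℂ),
        (T * X ⊗ₖ Y).trace = ((Matrix.of fun k l =>
          (X * Matrix.of fun i j => T (i, k) (j, l)).trace) * Y).trace := by
      intro X Y
      simp only [Matrix.trace, Matrix.diag, Matrix.mul_apply, Fintype.sum_prod_type,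
        Matrix.kroneckerMap_apply, Matrix.of_apply, Finset.sum_mul]
      rw [Finset.sum_comm]
      refine Finset.sum_congr rfl fun k _ => ?_
      conv_lhs => rw [Finset.sum_comm]
      conv_rhs => rw [Finset.sum_comm]
      refine Finset.sum_congr rfl fun j _ => ?_
      rw [Finset.sum_comm]
      refine Finset.sum_congr rfl fun l _ => Finset.sum_congr rfl fun i _ => ?_
      ring
    -- One leg at a time: contracting T with G leaves a self-intertwiner of u, which allows F to
    -- become F⁻¹; contracting with F⁻¹ then leaves one of v, which allows G to become G⁻¹.
    rw [Matrix.inv_kronecker, key, hF.trace_eq _ (hT.partial_trace_right hv hG.intertwines),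
      ← key, key', hG.trace_eq _ (hT.partial_trace_left hu
        (inv_intertwines hF.posDef hF.intertwines)), ← key']

end Tensor

/-! ### Construction and properties of f_{1/4}. -/

section QuarterFunctional

open scoped Kronecker

variable {H : Type*} [Ring H] [StarRing H] [HopfAlgebra ℂ H] [StarModule ℂ H]

/-- The positive fourth root of the canonical intertwiner. -/
structure IsCanonicalRoot {I : Type*} [Fintype I] [DecidableEq I] (w : Matrix I I H)
    (R : Matrix I I ℂ) : Prop where
  posDef : R.PosDef
  pow_four : IsCanonicalIntertwiner w (R ^ 4)

section

variable {I J : Type*} [Fintype I] [DecidableEq I] [Fintype J] [DecidableEq J]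

theorem IsCanonicalRoot.exists_functional {w : Matrix I I H} (hw : IsUCorep w)
    {R : Matrix I I ℂ} (hR : IsCanonicalRoot w R) : ∃ f : H →ₗ[ℂ] ℂ, w.map f = R :=
  QuantumCoaction.exists_functional hw fun _ hT =>
    mul_eq_mul_of_pow_four hR.posDef hR.posDef (hR.pow_four.commute hw hT)

theorem IsCanonicalRoot.fromBlocks {u : Matrix I I H} {w : Matrix J J H}
    {R : Matrix I I ℂ} {S : Matrix J J ℂ} (hR : IsCanonicalRoot u R) (hS : IsCanonicalRoot w S) :
    IsCanonicalRoot (Matrix.fromBlocks u 0 0 w) (Matrix.fromBlocks R 0 0 S) := by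
  refine ⟨posDef_fromBlocks_diagonal hR.posDef hS.posDef, ?_⟩
  rw [Matrix.fromBlocks_diagonal_pow]
  exact hR.pow_four.fromBlocks hS.pow_four

/-- The direct sum also has the self-intertwiners mixing u and w. Since its root commutes with these
too, one functional can serve both summands. -/
theorem IsCanonicalRoot.exists_functional_pair {u : Matrix I I H} {w : Matrix J J H}
    (hu : IsUCorep u) (hw : IsUCorep w) {R : Matrix I I ℂ} {S : Matrix J J ℂ}
    (hR : IsCanonicalRoot u R) (hS : IsCanonicalRoot w S) :
    ∃ f : H →ₗ[ℂ] ℂ, u.map f = R ∧ w.map f = S := by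
  obtain ⟨f, hf⟩ := (hR.fromBlocks hS).exists_functional (hu.fromBlocks hw)
  rw [Matrix.fromBlocks_map, Matrix.fromBlocks_inj] at hf
  exact ⟨f, hf.1, hf.2.2.2⟩

theorem kronecker_pow (A : Matrix I I ℂ) (B : Matrix J J ℂ) (k : ℕ) :
    (A ⊗ₖ B) ^ k = (A ^ k) ⊗ₖ (B ^ k) := by
  induction k with
  | zero => simp
  | succ k ih => rw [pow_succ, ih, ← Matrix.mul_kronecker_mul, pow_succ, pow_succ]

variable [IsCQGAlgebra H]

theorem IsCanonicalRoot.tensor {u : Matrix I I H} {w : Matrix J J H}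
    (hu : IsUCorep u) (hw : IsUCorep w) {R : Matrix I I ℂ} {S : Matrix J J ℂ}
    (hR : IsCanonicalRoot u R) (hS : IsCanonicalRoot w S) :
    IsCanonicalRoot (tensorMat u w) (R ⊗ₖ S) := by
  refine ⟨hR.posDef.kronecker hS.posDef, ?_⟩
  rw [kronecker_pow]
  exact hR.pow_four.tensor hu hw hS.pow_four

end

variable [IsCQGAlgebra H]

theorem IsUCorep.exists_canonicalRoot {I : Type} [Fintype I] [DecidableEq I]
    {w : Matrix I I H} (hw : IsUCorep w) : ∃ R : Matrix I I ℂ, IsCanonicalRoot w R := by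
  obtain ⟨F, hF⟩ := hw.exists_canonicalIntertwiner
  obtain ⟨R, hR, rfl⟩ := exists_fourthRoot hF.posDef
  exact ⟨R, hR, hF⟩

variable (H) in
-- The value at a is computed in any corepresentation having a among the span of its coefficients;
-- `IsCanonicalRoot.exists_functional_pair` makes it independent of the choice. Linearity holds
-- because finitely many elements fit into one corepresentation.
theorem exists_quarter_functional : ∃ f : H →ₗ[ℂ] ℂ, ∀ (I : Type) [Fintype I] [DecidableEq I]
    (w : Matrix I I H) (R : Matrix I I ℂ), IsUCorep w → IsCanonicalRoot w R → w.map f = R := by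
  have key : ∀ a : H, ∃ c : ℂ, ∀ (I : Type) [Fintype I] [DecidableEq I] (w : Matrix I I H)
      (g : H →ₗ[ℂ] ℂ), IsUCorep w → IsCanonicalRoot w (w.map g) → a ∈ coeffSpace w → g a = c := by
    intro a
    obtain ⟨J, _, _, x, hx, hxa⟩ := exists_mem_coeffSpace a
    obtain ⟨S, hS⟩ := hx.exists_canonicalRoot
    obtain ⟨g₀, hg₀⟩ := hS.exists_functional hx
    refine ⟨g₀ a, fun I _ _ w g hw hg hwa => ?_⟩
    obtain ⟨f, hf1, hf2⟩ := hS.exists_functional_pair hx hw hg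
    rw [← eq_of_mem_coeffSpace hf2 hwa, ← eq_of_mem_coeffSpace (hf1.trans hg₀.symm) hxa]
  choose φ hφ using key
  have hlin : ∀ s : Finset H, ∃ g : H →ₗ[ℂ] ℂ, ∀ a ∈ s, φ a = g a := by
    intro s
    obtain ⟨J, _, _, x, hx, hxs⟩ := exists_forall_mem_coeffSpace s
    obtain ⟨S, hS⟩ := hx.exists_canonicalRoot
    obtain ⟨g, rfl⟩ := hS.exists_functional hx
    exact ⟨g, fun a ha => (hφ a J x g hx hS (hxs a ha)).symm⟩
  classical
  refine ⟨{ toFun := φ, map_add' := fun a b => ?_, map_smul' := fun c a => ?_ },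
    fun I _ _ w R hw hR => ?_⟩
  · obtain ⟨g, hg⟩ := hlin {a, b, a + b}
    rw [hg a (by simp), hg b (by simp), hg (a + b) (by simp), map_add]
  · obtain ⟨g, hg⟩ := hlin {a, c • a}
    rw [hg a (by simp), hg (c • a) (by simp), map_smul, RingHom.id_apply]
  · obtain ⟨g, rfl⟩ := hR.exists_functional hw
    ext i j
    exact (hφ _ I w g hw hR (coeff_mem w i j)).symm

theorem isCanonicalIntertwiner_of_irred {n : ℕ} {u : Matrix (Fin n) (Fin n) H}
    {F : Matrix (Fin n) (Fin n) ℂ} (hF : F.PosDef) (hu : IsIrredUnitaryCorep u)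
    (h : IsWoronowiczMatrix u F) : IsCanonicalIntertwiner u F := by
  refine ⟨hF, h.intertwines, fun T hT => ?_⟩
  obtain ⟨c, rfl⟩ := hu.irreducible T hT
  simp [h.trace_eq]

theorem IsCanonicalIntertwiner.isWoronowiczMatrix {n : ℕ} {u : Matrix (Fin n) (Fin n) H}
    {F : Matrix (Fin n) (Fin n) ℂ} (h : IsCanonicalIntertwiner u F) : IsWoronowiczMatrix u F :=
  ⟨h.intertwines, by simpa using h.trace_eq 1 (isSelfIntertwiner_one u)⟩

variable (H) in
theorem woronowiczFunctional_quarter_spec :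
    IsWoronowiczFunctional (1 / 4) (woronowiczFunctional H (1 / 4)) := by
  have h : ∃ f : H →ₗ[ℂ] ℂ, IsWoronowiczFunctional (1 / 4) f := by
    obtain ⟨f, hf⟩ := exists_quarter_functional H
    refine ⟨f, fun n u F hF hu hFu => ?_⟩
    obtain ⟨R, hR, hRF⟩ := exists_fourthRoot hF
    rw [posDefCpow_quarter hF hR hRF]
    refine hf _ u R hu.toIsUnitaryCorep.isUCorep ⟨hR, ?_⟩
    rw [hRF]
    exact isCanonicalIntertwiner_of_irred hF hu hFu
  rw [woronowiczFunctional, dif_pos h]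
  exact h.choose_spec

/-- The definition constrains f_{1/4} on irreducible corepresentations only; decomposition extends
its agreement with the glued functional to all unitary ones. -/
theorem map_woronowiczFunctional_quarter {I : Type} [Fintype I] [DecidableEq I]
    {w : Matrix I I H} (hw : IsUCorep w) {R : Matrix I I ℂ} (hR : IsCanonicalRoot w R) :
    w.map (woronowiczFunctional H (1 / 4)) = R := by
  obtain ⟨f, hf⟩ := exists_quarter_functional H
  rw [← hf I w R hw hR]
  refine ucorep_induction
    (P := fun I _ _ w => w.map (woronowiczFunctional H (1 / 4)) = w.map f) ?_ ?_ ?_ I w hw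
  · intro n u hu
    obtain ⟨S, hS⟩ := hu.toIsUnitaryCorep.isUCorep.exists_canonicalRoot
    rw [hf _ u S hu.toIsUnitaryCorep.isUCorep hS,
      woronowiczFunctional_quarter_spec H n u _ (posDef_pow hS.posDef 4) hu
        hS.pow_four.isWoronowiczMatrix, posDefCpow_quarter _ hS.posDef rfl]
  · intro I J _ _ _ _ u V _ _ _ ih
    rw [map_mul_toH, map_toH_mul, ih, map_mul_toH, map_toH_mul]
  · intro I J _ _ _ _ u w _ _ ihu ihw
    rw [Matrix.fromBlocks_map, Matrix.fromBlocks_map, ihu, ihw]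
    simp

theorem isCanonicalRoot_map {I : Type} [Fintype I] [DecidableEq I]
    {w : Matrix I I H} (hw : IsUCorep w) :
    IsCanonicalRoot w (w.map (woronowiczFunctional H (1 / 4))) := by
  obtain ⟨R, hR⟩ := hw.exists_canonicalRoot
  rwa [map_woronowiczFunctional_quarter hw hR]

/-- The canonical root of a tensor product is the Kronecker product of the roots; read entrywise,
this is multiplicativity on coefficients. -/
theorem woronowiczFunctional_quarter_mul (a b : H) :
    woronowiczFunctional H (1 / 4) (a * b) =
      woronowiczFunctional H (1 / 4) a * woronowiczFunctional H (1 / 4) b := by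
  set f := woronowiczFunctional H (1 / 4) with hf
  obtain ⟨I, _, _, u, hu, ha⟩ := exists_mem_coeffSpace a
  obtain ⟨J, _, _, w, hw, hb⟩ := exists_mem_coeffSpace b
  have h := map_woronowiczFunctional_quarter (hu.tensor hw)
    ((isCanonicalRoot_map hu).tensor hu hw (isCanonicalRoot_map hw))
  have h1 : ∀ i j k l, f (u i j * w k l) = f (u i j) * f (w k l) := fun i j k l =>
    congrFun (congrFun h (i, k)) (j, l)
  have h2 : ∀ i j, f (u i j * b) = f (u i j) * f b := fun i j => by
    refine LinearMap.eqOn_span (f := f ∘ₗ LinearMap.mulLeft ℂ (u i j))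
      (g := LinearMap.mulLeft ℂ (f (u i j)) ∘ₗ f) ?_ hb
    rintro _ ⟨p, rfl⟩
    exact h1 i j p.1 p.2
  refine LinearMap.eqOn_span (f := f ∘ₗ LinearMap.mulRight ℂ b)
    (g := LinearMap.mulRight ℂ (f b) ∘ₗ f) ?_ ha
  rintro _ ⟨p, rfl⟩
  exact h2 p.1 p.2

theorem woronowiczFunctional_quarter_one : woronowiczFunctional H (1 / 4) 1 = 1 := by
  have hu : IsUCorep (1 : Matrix Unit Unit H) := by
    refine ⟨⟨fun i j => ?_, fun i j => ?_⟩, by simp, by simp⟩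
    · simp [Algebra.TensorProduct.one_def]
    · simp
  have hR : IsCanonicalRoot (1 : Matrix Unit Unit H) 1 := by
    refine ⟨Matrix.PosDef.one, ?_, ?_, ?_⟩
    · rw [one_pow]; exact Matrix.PosDef.one
    · rw [one_pow, toH_one]
      ext
      simp [antipodeSq]
    · intro T _
      simp
  have := congrFun (congrFun (map_woronowiczFunctional_quarter hu hR) ()) ()
  simpa using this

/-- The functional `a ↦ conj (f (a*))`. -/
def starConj (f : H →ₗ[ℂ] ℂ) : H →ₗ[ℂ] ℂ where
  toFun a := star (f (star a))
  map_add' a b := by simp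
  map_smul' c a := by simp

/-- Apply the multiplicative f to w*w = 1 and conjugate, using that f(w) is Hermitian. -/
theorem map_starConj_mul_map {I : Type} [Fintype I] [DecidableEq I]
    {w : Matrix I I H} (hw : IsUCorep w) :
    w.map (woronowiczFunctional H (1 / 4)) * w.map (starConj (woronowiczFunctional H (1 / 4))) =
      1 := by
  have hR := (isCanonicalRoot_map hw).posDef.isHermitian
  set f := woronowiczFunctional H (1 / 4) with hf
  have hmul : ∀ a b, f (a * b) = f a * f b := woronowiczFunctional_quarter_mul
  have hone : f 1 = 1 := woronowiczFunctional_quarter_one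
  have h1 : ∀ i j, f (w i j) = star (f (w j i)) := fun i j => (congrFun (congrFun hR i) j).symm
  ext i j
  have h2 := congrArg f (congrFun (congrFun hw.conjTranspose_mul_self j) i)
  simp only [Matrix.mul_apply, Matrix.conjTranspose_apply, map_sum, hmul] at h2
  have h3 := congrArg star h2
  simp only [star_sum, star_mul', ← h1] at h3
  simp only [Matrix.mul_apply, Matrix.map_apply, starConj, LinearMap.coe_mk, AddHom.coe_mk]
  calc _ = _ := Finset.sum_congr rfl fun k _ => mul_comm _ _
    _ = _ := h3
    _ = _ := by
      simp only [Matrix.one_apply, eq_comm (a := j)]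
      split_ifs <;> simp [hone]

end QuarterFunctional

/-! ### The coaction as a unitary corepresentation on `A`. -/

section CoactionMatrix

variable {H : Type*} [Ring H] [StarRing H] [HopfAlgebra ℂ H] [StarModule ℂ H]
variable {A : Type*} [CStarAlgebra A]

theorem slice_eq (f : H →ₗ[ℂ] ℂ) (v : A →⋆ₐ[ℂ] A ⊗[ℂ] H) (a : A) :
    slice f v a = TensorProduct.rid ℂ A (LinearMap.lTensor A f (v a)) := rfl

theorem slice_mul {f : H →ₗ[ℂ] ℂ} (hf : ∀ a b, f (a * b) = f a * f b)
    (v : A →⋆ₐ[ℂ] A ⊗[ℂ] H) (a b : A) : slice f v (a * b) = slice f v a * slice f v b := by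
  have h : ∀ x y : A ⊗[ℂ] H, TensorProduct.rid ℂ A (LinearMap.lTensor A f (x * y)) =
      TensorProduct.rid ℂ A (LinearMap.lTensor A f x) *
        TensorProduct.rid ℂ A (LinearMap.lTensor A f y) := by
    intro x y
    induction x using TensorProduct.induction_on with
    | zero => simp
    | add x₁ x₂ h₁ h₂ => simp only [add_mul, map_add, h₁, h₂]
    | tmul a h =>
      induction y using TensorProduct.induction_on with
      | zero => simp
      | add y₁ y₂ h₁ h₂ => simp only [mul_add, map_add, h₁, h₂]
      | tmul b k => simp [hf, smul_smul, mul_comm]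
  rw [slice_eq, slice_eq, slice_eq, map_mul, h]

theorem star_slice_star (f : H →ₗ[ℂ] ℂ) (v : A →⋆ₐ[ℂ] A ⊗[ℂ] H) (a : A) :
    star (slice f v (star a)) = slice (starConj f) v a := by
  have h : ∀ x : A ⊗[ℂ] H, star (TensorProduct.rid ℂ A (LinearMap.lTensor A f (star x))) =
      TensorProduct.rid ℂ A (LinearMap.lTensor A (starConj f) x) := by
    intro x
    induction x using TensorProduct.induction_on with
    | zero => simp
    | add x₁ x₂ h₁ h₂ => simp only [star_add, map_add, h₁, h₂]
    | tmul a h => simp [TensorProduct.star_tmul, starConj]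
  rw [slice_eq, slice_eq, map_star, h]

/-- Conjugation by the square root of an invariant form makes p an isometry, and the antipode
supplies the two-sided inverse. -/
theorem IsCorep.exists_isUCorep [IsCQGAlgebra H] {I : Type*} [Fintype I] [DecidableEq I]
    {p : Matrix I I H} (hp : IsCorep p) : ∃ K : Matrix I I ℂ, K.PosDef ∧
      IsUCorep (toH H K * p * toH H K⁻¹) := by
  obtain ⟨G, hG, h⟩ := hp.exists_posDef_invariant
  -- The square root of G is taken as the square of its fourth root.
  obtain ⟨R, hR, hRG⟩ := exists_fourthRoot hG
  have hK : (R ^ 2).PosDef := posDef_pow hR 2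
  have hKG : R ^ 2 * R ^ 2 = G := by rw [← pow_add, hRG]
  set K := R ^ 2
  have hK1 := posDef_mul_inv hK
  have hK2 := posDef_inv_mul hK
  have hu := hp.congr hK1 hK2
  refine ⟨K, hK, ?_⟩
  have hKh : Kᴴ = K := hK.isHermitian
  have hKih : (K⁻¹)ᴴ = K⁻¹ := hK.inv.isHermitian
  have h1 : (toH H K * p * toH H K⁻¹)ᴴ * (toH H K * p * toH H K⁻¹) = 1 := by
    simp only [Matrix.conjTranspose_mul, toH_conjTranspose, hKh, hKih]
    calc _ = toH H K⁻¹ * (pᴴ * (toH H K * toH H K) * p) * toH H K⁻¹ := by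
          simp only [Matrix.mul_assoc]
      _ = 1 := by
          rw [← toH_mul, hKG, h, ← hKG, ← toH_mul, ← toH_mul, ← Matrix.mul_assoc, hK2,
            Matrix.one_mul, hK1, toH_one]
  have h2 := hu.self_mul_antipode
  have h3 : (toH H K * p * toH H K⁻¹)ᴴ =
      (toH H K * p * toH H K⁻¹).map (HopfAlgebra.antipode ℂ) := by
    rw [← Matrix.mul_one (toH H K * p * toH H K⁻¹)ᴴ, ← h2, ← Matrix.mul_assoc, h1, Matrix.one_mul]
  exact ⟨hu, h1, by rw [h3, h2]⟩

theorem eq_of_sum_basis_tmul_eq {ι V N : Type*} [Fintype ι] [AddCommGroup V] [Module ℂ V]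
    [AddCommGroup N] [Module ℂ N] (b : Module.Basis ι ℂ V) {c c' : ι → N}
    (h : ∑ i, b i ⊗ₜ[ℂ] c i = ∑ i, b i ⊗ₜ[ℂ] c' i) : c = c' := by
  classical
  ext k
  have h1 : ∀ c : ι → N,
      TensorProduct.equivFinsuppOfBasisLeft b (∑ i, b i ⊗ₜ[ℂ] c i) k = c k := fun c => by
    simp [Finsupp.finsetSum_apply, Finsupp.single_apply]
  rw [← h1 c, h, h1]

theorem IsCoaction.exists_isCorep [FiniteDimensional ℂ A] {v : A →⋆ₐ[ℂ] A ⊗[ℂ] H}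
    (hv : IsCoaction v) : ∃ (d : ℕ) (Φ : A ≃ₗ[ℂ] (Fin d → ℂ)) (p : Matrix (Fin d) (Fin d) H),
      IsCorep p ∧ ∀ f a, Φ (slice f v a) = p.map f *ᵥ Φ a := by
  let b := Module.finBasis ℂ A
  have hex : ∀ x : A ⊗[ℂ] H, ∃ c : Fin (Module.finrank ℂ A) → H, x = ∑ i, b i ⊗ₜ[ℂ] c i :=
    fun x => by
      obtain ⟨c, hc⟩ := TensorProduct.eq_repr_basis_left b x
      exact ⟨c, by rw [← hc, Finsupp.sum_fintype _ _ (by simp)]⟩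
  choose q hq using fun j => hex (v (b j))
  have hslice : ∀ f j, slice f v (b j) = ∑ i, f (q j i) • b i := fun f j => by
    rw [slice_eq, hq]
    simp
  refine ⟨_, b.equivFun, Matrix.of fun i j => q j i, ⟨fun i j => ?_, fun i j => ?_⟩,
    fun f a => ?_⟩
  · have h := hv.coassoc (b j)
    rw [hq] at h
    have h1 : ∑ k, b k ⊗ₜ[ℂ] (∑ i, q i k ⊗ₜ[ℂ] q j i) =
        ∑ k, b k ⊗ₜ[ℂ] (Coalgebra.comul (R := ℂ) (q j k)) := by
      calc _ = ∑ i, ∑ k, b k ⊗ₜ[ℂ] (q i k ⊗ₜ[ℂ] q j i) := by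
            simp only [TensorProduct.tmul_sum]
            exact Finset.sum_comm
        _ = _ := by
            simpa [hq, TensorProduct.sum_tmul] using h
    exact (congrFun (eq_of_sum_basis_tmul_eq b h1) i).symm
  · have h := hv.counital (b j)
    change slice (Coalgebra.counit (R := ℂ) (A := H)) v (b j) = b j at h
    rw [hslice] at h
    have h1 := congrArg (fun x => b.repr x i) h
    simpa [Finsupp.single_apply, eq_comm] using h1
  · have h1 : slice f v a = ∑ j, b.repr a j • slice f v (b j) := by
      have h2 := congrArg (slice f v) (b.sum_repr a)
      rw [map_sum] at h2
      simpa only [map_smul] using h2.symm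
    rw [h1]
    ext i
    simp [hslice, Matrix.mulVec, dotProduct, Finsupp.single_apply, mul_comm]

/-- `(id ⊗ f) v` is given by a unitary corepresentation in suitable coordinates. -/
theorem IsCoaction.exists_isUCorep [IsCQGAlgebra H] [FiniteDimensional ℂ A]
    {v : A →⋆ₐ[ℂ] A ⊗[ℂ] H} (hv : IsCoaction v) :
    ∃ (d : ℕ) (Φ : A ≃ₗ[ℂ] (Fin d → ℂ)) (u : Matrix (Fin d) (Fin d) H),
      IsUCorep u ∧ ∀ f a, Φ (slice f v a) = u.map f *ᵥ Φ a := by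
  obtain ⟨d, Φ, p, hp, h⟩ := hv.exists_isCorep
  obtain ⟨K, hK, hu⟩ := hp.exists_isUCorep
  have hK1 := posDef_mul_inv hK
  have hK2 := posDef_inv_mul hK
  let E : (Fin d → ℂ) ≃ₗ[ℂ] (Fin d → ℂ) := LinearEquiv.ofLinearMap K.mulVecLin K⁻¹.mulVecLin
    (by rw [← Matrix.mulVecLin_mul, hK1, Matrix.mulVecLin_one])
    (by rw [← Matrix.mulVecLin_mul, hK2, Matrix.mulVecLin_one])
  refine ⟨d, Φ.trans E, _, hu, fun f a => ?_⟩
  change K *ᵥ Φ (slice f v a) = _ *ᵥ (K *ᵥ Φ a)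
  rw [h, map_mul_toH, map_toH_mul, Matrix.mulVec_mulVec, Matrix.mulVec_mulVec, Matrix.mul_assoc (K * _), hK2, Matrix.mul_one]

/-- The map `(id ⊗ f_{1/4}) v` is positive with respect to some inner product, and `a ↦ θ(a*)*` is
its inverse. -/
theorem IsCoaction.exists_posDef [IsCQGAlgebra H] [FiniteDimensional ℂ A]
    {v : A →⋆ₐ[ℂ] A ⊗[ℂ] H} (hv : IsCoaction v) :
    (∀ a, slice (woronowiczFunctional H (1 / 4)) v
      (star (slice (woronowiczFunctional H (1 / 4)) v (star a))) = a) ∧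
    ∃ (d : ℕ) (Φ : A ≃ₗ[ℂ] (Fin d → ℂ)) (R : Matrix (Fin d) (Fin d) ℂ), R.PosDef ∧
      ∀ a, Φ (slice (woronowiczFunctional H (1 / 4)) v a) = R *ᵥ Φ a := by
  obtain ⟨d, Φ, u, hu, h⟩ := hv.exists_isUCorep
  refine ⟨fun a => Φ.injective ?_, d, Φ, _, (isCanonicalRoot_map hu).posDef, h _⟩
  rw [star_slice_star, h, h, Matrix.mulVec_mulVec, map_starConj_mul_map hu, Matrix.one_mulVec]

end CoactionMatrix

/-! ### Automorphisms of direct sums of matrix algebras. -/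

section BlockAlgebra

/-- Skolem–Noether for a matrix algebra, through automorphisms of the endomorphism algebra of ℂⁿ. -/
theorem exists_conj_of_algEquiv {n : ℕ} (φ : Matrix (Fin n) (Fin n) ℂ ≃ₐ[ℂ] Matrix (Fin n) (Fin n) ℂ) :
    ∃ B C : Matrix (Fin n) (Fin n) ℂ, B * C = 1 ∧ C * B = 1 ∧ ∀ m, φ m = B * m * C := by
  obtain ⟨T, hT⟩ := AlgEquiv.eq_linearEquivConjAlgEquiv
    ((Matrix.toLinAlgEquiv'.symm.trans φ).trans Matrix.toLinAlgEquiv')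
  refine ⟨LinearMap.toMatrix' T.toLinearMap, LinearMap.toMatrix' T.symm.toLinearMap, ?_, ?_,
    fun m => ?_⟩
  · rw [← LinearMap.toMatrix'_comp]
    simp
  · rw [← LinearMap.toMatrix'_comp]
    simp
  · have h := congrArg (fun ψ => ψ (Matrix.toLin' m)) hT
    have h1 : Matrix.toLin' (φ m) = T.toLinearMap ∘ₗ Matrix.toLin' m ∘ₗ T.symm.toLinearMap := by
      have h2 : Matrix.toLinAlgEquiv'.symm (Matrix.toLin' m) = m :=
        Matrix.toLinAlgEquiv'.symm_apply_apply m
      simp only [AlgEquiv.trans_apply, h2] at h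
      exact h
    have h3 := congrArg LinearMap.toMatrix' h1
    rw [LinearMap.toMatrix'_toLin', LinearMap.toMatrix'_comp, LinearMap.toMatrix'_comp,
      LinearMap.toMatrix'_toLin'] at h3
    rw [h3, Matrix.mul_assoc]

theorem eq_smul_one_of_commute {n : ℕ} {M : Matrix (Fin n) (Fin n) ℂ}
    (h : ∀ m, M * m = m * M) : ∃ c : ℂ, M = c • (1 : Matrix (Fin n) (Fin n) ℂ) := by
  obtain ⟨c, hc⟩ := Matrix.mem_range_scalar_of_commute_single (M := M)
    fun i j _ => (h _).symm
  exact ⟨c, by rw [← hc, Matrix.scalar_apply, Matrix.smul_one_eq_diagonal]⟩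

/-- An automorphism of a matrix algebra with positive eigenvalues, and whose inverse is
`m ↦ φ(m*)*`, is implemented by a positive definite matrix. -/
theorem exists_posDef_conj {n : ℕ} [NeZero n]
    (φ : Matrix (Fin n) (Fin n) ℂ ≃ₐ[ℂ] Matrix (Fin n) (Fin n) ℂ)
    (hstar : ∀ m, φ (φ mᴴ)ᴴ = m)
    (hpos : ∀ (c : ℂ) m, m ≠ 0 → φ m = c • m → 0 < c) :
    ∃ B : Matrix (Fin n) (Fin n) ℂ, B.PosDef ∧ ∀ m, φ m = B * m * B⁻¹ := by
  have hone : (1 : Matrix (Fin n) (Fin n) ℂ) ≠ 0 := one_ne_zero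
  obtain ⟨B, C, hBC, hCB, hφ⟩ := exists_conj_of_algEquiv φ
  have hBC' : Cᴴ * Bᴴ = 1 := by rw [← Matrix.conjTranspose_mul, hBC, Matrix.conjTranspose_one]
  have hCB' : Bᴴ * Cᴴ = 1 := by rw [← Matrix.conjTranspose_mul, hCB, Matrix.conjTranspose_one]
  -- With C = B⁻¹, the hypothesis on the inverse says that BC* is central, so B is a multiple of B*.
  have hcomm : ∀ m, (B * Cᴴ) * m = m * (B * Cᴴ) := by
    intro m
    have h := hstar m
    rw [hφ, hφ, Matrix.conjTranspose_mul, Matrix.conjTranspose_mul,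
      Matrix.conjTranspose_conjTranspose] at h
    calc B * Cᴴ * m = B * (Cᴴ * (m * Bᴴ)) * C * (B * Cᴴ) := by
          have : B * (Cᴴ * (m * Bᴴ)) * C * (B * Cᴴ) = B * Cᴴ * m * (Bᴴ * (C * B) * Cᴴ) := by
            simp only [Matrix.mul_assoc]
          rw [this, hCB, Matrix.mul_one, hCB', Matrix.mul_one]
      _ = m * (B * Cᴴ) := by rw [h]
  obtain ⟨c, hc⟩ := eq_smul_one_of_commute hcomm
  have hB : B = c • Bᴴ := by
    calc B = (B * Cᴴ) * Bᴴ := by rw [Matrix.mul_assoc, hBC', Matrix.mul_one]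
      _ = _ := by rw [hc, Matrix.smul_mul, Matrix.one_mul]
  have hB0 : B ≠ 0 := fun h => hone (by rw [← hBC, h, Matrix.zero_mul])
  have hc0 : c ≠ 0 := fun h => hB0 (by rw [hB, h, zero_smul])
  have hBH : Bᴴ = c⁻¹ • B := by
    conv_rhs => rw [hB, smul_smul, inv_mul_cancel₀ hc0, one_smul]
  -- B + B* is a multiple of B, and a nonzero one unless B* = −B; in that case iB is Hermitian.
  obtain ⟨t, ht0, htH⟩ : ∃ t : ℂ, t ≠ 0 ∧ (t • B).IsHermitian := by
    by_cases h1 : 1 + c⁻¹ = 0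
    · refine ⟨Complex.I, Complex.I_ne_zero, ?_⟩
      have : c⁻¹ = -1 := by linear_combination h1
      rw [this] at hBH
      simp [Matrix.IsHermitian, Matrix.conjTranspose_smul, hBH]
    · refine ⟨1 + c⁻¹, h1, ?_⟩
      have : (1 + c⁻¹) • B = B + Bᴴ := by rw [add_smul, one_smul, hBH]
      rw [this, Matrix.IsHermitian, Matrix.conjTranspose_add, Matrix.conjTranspose_conjTranspose,
        add_comm]
  set D := t • B with hD
  have hDC : D * (t⁻¹ • C) = 1 := by
    rw [hD, Matrix.smul_mul, Matrix.mul_smul, smul_smul, mul_inv_cancel₀ ht0, one_smul, hBC]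
  have hφD : ∀ m, φ m * D = D * m := fun m => by
    rw [hφ, hD, Matrix.mul_smul, Matrix.mul_assoc, hCB, Matrix.mul_one, Matrix.smul_mul]
  clear_value D
  set U : Matrix (Fin n) (Fin n) ℂ := (htH.eigenvectorUnitary : Matrix (Fin n) (Fin n) ℂ) with hU
  have hU1 : U * Uᴴ = 1 := eigenvectorUnitary_mul_conjTranspose htH
  have hU2 : Uᴴ * U = 1 := eigenvectorUnitary_conjTranspose_mul htH
  have hDU : D = U * Matrix.diagonal (fun i => ((htH.eigenvalues i : ℝ) : ℂ)) * Uᴴ :=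
    isHermitian_eq_conj_diagonal htH
  set d := htH.eigenvalues
  have hCD : (t⁻¹ • C) * D = 1 := mul_eq_one_comm.1 hDC
  -- Matrix units in an eigenbasis of D are eigenvectors of φ with eigenvalues dᵢ/dⱼ, so all dᵢ have
  -- the same sign, and multiplying by one of them makes D positive.
  let M : Fin n → Fin n → Matrix (Fin n) (Fin n) ℂ := fun i j => U * Matrix.single i j 1 * Uᴴ
  have hM0 : ∀ i j, M i j ≠ 0 := fun i j h => by
    have h1 : Uᴴ * M i j * U = Matrix.single i j 1 := by
      calc Uᴴ * M i j * U = (Uᴴ * U) * Matrix.single i j 1 * (Uᴴ * U) := by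
            simp only [M, Matrix.mul_assoc]
        _ = _ := by rw [hU2, Matrix.one_mul, Matrix.mul_one]
    rw [h, Matrix.mul_zero, Matrix.zero_mul] at h1
    have h2 := congrFun (congrFun h1 i) j
    simp at h2
  have hDM : ∀ i j, D * M i j = ((d i : ℝ) : ℂ) • M i j := fun i j => by
    have h1 : Matrix.diagonal (fun i => ((d i : ℝ) : ℂ)) * Matrix.single i j 1 =
        ((d i : ℝ) : ℂ) • Matrix.single i j (1 : ℂ) := by
      ext a b
      simp only [Matrix.diagonal_mul, Matrix.smul_apply, Matrix.single_apply, smul_eq_mul]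
      split_ifs with h
      · simp [h.1]
      · simp
    calc D * M i j = U * Matrix.diagonal (fun i => ((d i : ℝ) : ℂ)) * (Uᴴ * U) *
          Matrix.single i j 1 * Uᴴ := by
          rw [hDU]; simp only [M, Matrix.mul_assoc]
      _ = U * (Matrix.diagonal (fun i => ((d i : ℝ) : ℂ)) * Matrix.single i j 1) * Uᴴ := by
          rw [hU2, Matrix.mul_one]; simp only [Matrix.mul_assoc]
      _ = _ := by rw [h1, Matrix.mul_smul, Matrix.smul_mul]
  have hMD : ∀ i j, M i j * D = ((d j : ℝ) : ℂ) • M i j := fun i j => by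
    have h1 : Matrix.single i j 1 * Matrix.diagonal (fun i => ((d i : ℝ) : ℂ)) =
        ((d j : ℝ) : ℂ) • Matrix.single i j (1 : ℂ) := by
      ext a b
      simp only [Matrix.mul_diagonal, Matrix.smul_apply, Matrix.single_apply, smul_eq_mul]
      split_ifs with h
      · simp [h.2]
      · simp
    calc M i j * D = U * Matrix.single i j 1 * (Uᴴ * U) *
          Matrix.diagonal (fun i => ((d i : ℝ) : ℂ)) * Uᴴ := by
          rw [hDU]; simp only [M, Matrix.mul_assoc]
      _ = U * (Matrix.single i j 1 * Matrix.diagonal (fun i => ((d i : ℝ) : ℂ))) * Uᴴ := by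
          rw [hU2, Matrix.mul_one]; simp only [Matrix.mul_assoc]
      _ = _ := by rw [h1, Matrix.mul_smul, Matrix.smul_mul]
  have hd0 : ∀ i, d i ≠ 0 := fun i h => hM0 i i <| by
    have h1 := hDM i i
    rw [h, Complex.ofReal_zero, zero_smul] at h1
    rw [← Matrix.one_mul (M i i), ← hCD, Matrix.mul_assoc, h1, Matrix.mul_zero]
  have hdd : ∀ i j, 0 < d i / d j := fun i j => by
    have hj : ((d j : ℝ) : ℂ) ≠ 0 := by exact_mod_cast hd0 j
    have h1 : φ (M i j) = (((d i : ℝ) : ℂ) / ((d j : ℝ) : ℂ)) • M i j := by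
      calc φ (M i j) = (φ (M i j) * D) * (t⁻¹ • C) := by
            rw [Matrix.mul_assoc, hDC, Matrix.mul_one]
        _ = ((((d i : ℝ) : ℂ) / ((d j : ℝ) : ℂ)) • M i j * D) * (t⁻¹ • C) := by
            rw [hφD, hDM, Matrix.smul_mul _ (M i j) D, hMD, smul_smul, div_mul_cancel₀ _ hj]
        _ = _ := by rw [Matrix.mul_assoc, hDC, Matrix.mul_one]
    have h2 := hpos _ _ (hM0 i j) h1
    exact_mod_cast h2
  have i0 : Fin n := ⟨0, Nat.pos_of_ne_zero (NeZero.ne n)⟩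
  have hsD : (((d i0 : ℝ) : ℂ) • D).PosDef := by
    have h1 : ((d i0 : ℝ) : ℂ) • D =
        U * Matrix.diagonal (fun i => ((d i0 * d i : ℝ) : ℂ)) * Uᴴ := by
      rw [hDU, ← Matrix.smul_mul, ← Matrix.mul_smul, ← Matrix.diagonal_smul]
      congr! 3
      ext i
      simp
    rw [h1]
    refine posDef_unitary_conj_diagonal hU1 fun i => ?_
    have := mul_pos (hdd i i0) (mul_self_pos.2 (hd0 i0))
    have h2 : d i / d i0 * (d i0 * d i0) = d i0 * d i := by
      field_simp [hd0 i0]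
    rwa [h2] at this
  refine ⟨_, hsD, fun m => ?_⟩
  have h1 : φ m * (((d i0 : ℝ) : ℂ) • D) = (((d i0 : ℝ) : ℂ) • D) * m := by
    rw [Matrix.mul_smul, hφD]
    exact (Matrix.smul_mul _ _ _).symm
  rw [← h1, Matrix.mul_assoc, posDef_mul_inv hsD, Matrix.mul_one]

/-- A vector fixed by a positive power of a positive definite matrix is fixed by the matrix. -/
theorem mulVec_eq_self_of_pow {I : Type*} [Fintype I] [DecidableEq I] {R : Matrix I I ℂ}
    (hR : R.PosDef) {k : ℕ} (hk : 0 < k) {y : I → ℂ} (h : R ^ k *ᵥ y = y) : R *ᵥ y = y := by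
  obtain ⟨k, rfl⟩ := Nat.exists_eq_succ_of_ne_zero hk.ne'
  -- R^(k+1) − 1 is R − 1 times this geometric sum, which is invertible because positive definite.
  have hS : (∑ i ∈ Finset.range (k + 1), R ^ i).PosDef := by
    rw [Finset.sum_range_succ', pow_zero]
    exact Matrix.PosDef.posSemidef_add
      (Matrix.posSemidef_sum _ fun i _ => hR.posSemidef.pow _) Matrix.PosDef.one
  have h1 : (∑ i ∈ Finset.range (k + 1), R ^ i) * (R - 1) = R ^ (k + 1) - 1 := geom_sum_mul _ _
  have h2 : (R - 1) *ᵥ y = 0 := by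
    calc (R - 1) *ᵥ y = (∑ i ∈ Finset.range (k + 1), R ^ i)⁻¹ *ᵥ
          ((∑ i ∈ Finset.range (k + 1), R ^ i) * (R - 1)) *ᵥ y := by
          rw [Matrix.mulVec_mulVec, ← Matrix.mul_assoc, posDef_inv_mul hS, Matrix.one_mul]
      _ = 0 := by
          rw [h1, Matrix.sub_mulVec, Matrix.one_mulVec]
          erw [h]
          rw [sub_self, Matrix.mulVec_zero]
  rwa [Matrix.sub_mulVec, Matrix.one_mulVec, sub_eq_zero] at h2

variable {ι : Type*} [Fintype ι] {n : ι → ℕ} [∀ i, NeZero (n i)]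

/-- A central element is scalar on each block, and an idempotent scalar is 0 or 1. -/
theorem finite_central_idempotents :
    {c : ∀ i, Matrix (Fin (n i)) (Fin (n i)) ℂ | c * c = c ∧ ∀ y, c * y = y * c}.Finite := by
  classical
  refine (Set.finite_range fun (s : ι → Bool) (i : ι) =>
    if s i then (1 : Matrix (Fin (n i)) (Fin (n i)) ℂ) else 0).subset ?_
  rintro c ⟨hc1, hc2⟩
  have h : ∀ i, c i = 0 ∨ c i = 1 := by
    intro i
    obtain ⟨t, ht⟩ := eq_smul_one_of_commute (M := c i) fun m => by
      have := congrFun (hc2 (Pi.single i m)) i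
      simpa using this
    have h1 := congrFun hc1 i
    rw [Pi.mul_apply, ht, smul_mul_smul_comm, one_mul] at h1
    have h2 : t * t = t := by
      have i0 : Fin (n i) := ⟨0, Nat.pos_of_ne_zero (NeZero.ne _)⟩
      simpa using congrFun (congrFun h1 i0) i0
    rcases mul_eq_zero.1 (show t * (t - 1) = 0 by linear_combination h2) with h3 | h3
    · left; rw [ht, h3, zero_smul]
    · right; rw [ht, sub_eq_zero.1 h3, one_smul]
  refine ⟨fun i => decide (c i = 1), funext fun i => ?_⟩
  rcases h i with h0 | h0
  · simp [h0]
  · simp [h0]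

theorem exists_posDef_conj_pi
    (θ : (∀ i, Matrix (Fin (n i)) (Fin (n i)) ℂ) →ₗ[ℂ] (∀ i, Matrix (Fin (n i)) (Fin (n i)) ℂ))
    (hmul : ∀ a b, θ (a * b) = θ a * θ b)
    (hstar : ∀ a, θ (star (θ (star a))) = a) {d : ℕ}
    (Φ : (∀ i, Matrix (Fin (n i)) (Fin (n i)) ℂ) ≃ₗ[ℂ] (Fin d → ℂ))
    {R : Matrix (Fin d) (Fin d) ℂ} (hR : R.PosDef) (hΦ : ∀ a, Φ (θ a) = R *ᵥ Φ a) :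
    ∃ B : ∀ i, Matrix (Fin (n i)) (Fin (n i)) ℂ, (∀ i, (B i).PosDef) ∧
      ∀ x i, θ x i = B i * x i * (B i)⁻¹ := by
  classical
  have hpow : ∀ k a, Φ (θ^[k] a) = R ^ k *ᵥ Φ a := by
    intro k
    induction k with
    | zero => intro a; simp
    | succ k ih => intro a; rw [Function.iterate_succ_apply', hΦ, ih, Matrix.mulVec_mulVec, pow_succ']
  -- The orbit of a central idempotent stays in a finite set, so two iterates agree; cancelling a
  -- power of R makes c periodic, and positivity of R makes it fixed.
  have hfix : ∀ c : ∀ i, Matrix (Fin (n i)) (Fin (n i)) ℂ, c * c = c → (∀ y, c * y = y * c) →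
      θ c = c := by
    intro c hc1 hc2
    have hmem : ∀ k, θ^[k] c ∈ {c : ∀ i, Matrix (Fin (n i)) (Fin (n i)) ℂ |
        c * c = c ∧ ∀ y, c * y = y * c} := by
      intro k
      induction k with
      | zero => exact ⟨hc1, hc2⟩
      | succ k ih =>
        rw [Function.iterate_succ_apply']
        refine ⟨by rw [← hmul, ih.1], fun y => ?_⟩
        rw [← hstar y, ← hmul, ih.2, hmul]
    obtain ⟨a, b, hab, h⟩ := finite_central_idempotents.exists_lt_map_eq_of_forall_mem hmem
    have h1 : R ^ a *ᵥ Φ c = R ^ b *ᵥ Φ c := by rw [← hpow, ← hpow]; exact congrArg Φ h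
    have h2 : R ^ (b - a) *ᵥ Φ c = Φ c := by
      have h3 := congrArg (fun z => (R ^ a)⁻¹ *ᵥ z) h1
      simp only [Matrix.mulVec_mulVec] at h3
      rw [posDef_inv_mul (posDef_pow hR a), Matrix.one_mulVec] at h3
      have h4 : R ^ b = R ^ a * R ^ (b - a) := by rw [← pow_add, Nat.add_sub_cancel' hab.le]
      rw [h4, ← Matrix.mul_assoc, posDef_inv_mul (posDef_pow hR a), Matrix.one_mul] at h3
      exact h3.symm
    refine Φ.injective ?_
    rw [hΦ, mulVec_eq_self_of_pow hR (Nat.sub_pos_of_lt hab) h2]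
  have hinj : Function.Injective θ := fun a b hab => by
    have h1 : R *ᵥ Φ a = R *ᵥ Φ b := by rw [← hΦ, ← hΦ, hab]
    have h2 := congrArg (fun z => R⁻¹ *ᵥ z) h1
    simp only [Matrix.mulVec_mulVec, posDef_inv_mul hR, Matrix.one_mulVec] at h2
    exact Φ.injective h2
  have hp : ∀ i, θ (Pi.single i 1) = Pi.single i 1 := fun i => hfix _
    (by rw [← Pi.single_mul, one_mul])
    fun y => by rw [← Pi.single_mul_left, ← Pi.single_mul_right, one_mul, mul_one]
  have hx : ∀ (i) (x : ∀ i, Matrix (Fin (n i)) (Fin (n i)) ℂ),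
      Pi.single i (x i) = x * Pi.single i 1 := fun i x => by
    rw [← Pi.single_mul_right, mul_one]
  have hloc : ∀ i x, θ (Pi.single i (x i)) = Pi.single i (θ x i) := fun i x => by
    rw [hx, hmul, hp, ← hx]
  have hloc' : ∀ i m, θ (Pi.single i m) = Pi.single i (θ (Pi.single i m) i) := fun i m => by
    simpa using hloc i (Pi.single i m)
  have hloc'' : ∀ i x, θ x i = θ (Pi.single i (x i)) i := fun i x => by
    rw [hloc]; simp
  let φ₀ : ∀ i, Matrix (Fin (n i)) (Fin (n i)) ℂ →ₐ[ℂ] Matrix (Fin (n i)) (Fin (n i)) ℂ :=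
    fun i => AlgHom.ofLinearMap
      (LinearMap.proj i ∘ₗ θ ∘ₗ LinearMap.single ℂ (fun i => Matrix (Fin (n i)) (Fin (n i)) ℂ) i)
      (by simp [hp]) (fun a b => by simp [Pi.single_mul, hmul])
  have hφ₀ : ∀ i m, φ₀ i m = θ (Pi.single i m) i := fun i m => rfl
  have hφinj : ∀ i, Function.Injective (φ₀ i) := fun i a b hab => by
    rw [hφ₀, hφ₀] at hab
    have h1 : θ (Pi.single i a) = θ (Pi.single i b) := by rw [hloc', hab, ← hloc']
    exact Pi.single_injective i (hinj h1)
  let φ : ∀ i, Matrix (Fin (n i)) (Fin (n i)) ℂ ≃ₐ[ℂ] Matrix (Fin (n i)) (Fin (n i)) ℂ :=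
    fun i => AlgEquiv.ofBijective (φ₀ i)
      ⟨hφinj i, (LinearMap.injective_iff_surjective (f := (φ₀ i).toLinearMap)).1 (hφinj i)⟩
  have hφ : ∀ i m, φ i m = θ (Pi.single i m) i := fun i m => rfl
  have key : ∀ i, ∃ B : Matrix (Fin (n i)) (Fin (n i)) ℂ, B.PosDef ∧
      ∀ m, φ i m = B * m * B⁻¹ := by
    intro i
    refine exists_posDef_conj (φ i) (fun m => ?_) fun c m hm h => ?_
    · have h1 := congrFun (hstar (Pi.single i m)) i
      have h2 : θ (star (Pi.single i m)) i = φ i mᴴ := by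
        rw [hloc'', Pi.star_apply, Pi.single_eq_same]; rfl
      rw [hloc'', Pi.star_apply, h2, Pi.single_eq_same] at h1
      exact h1
    · rw [hφ] at h
      have h1 : θ (Pi.single i m) = c • Pi.single i m := by
        rw [hloc', h, Pi.single_smul]
      have h2 : R *ᵥ Φ (Pi.single i m) = c • Φ (Pi.single i m) := by
        rw [← hΦ, h1, map_smul]
      have h3 : Φ (Pi.single i m) ≠ 0 := by
        rw [Ne, LinearEquiv.map_eq_zero_iff, Pi.single_eq_zero_iff]
        exact hm
      have h4 := hR.dotProduct_mulVec_pos h3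
      rw [h2, dotProduct_smul, smul_eq_mul] at h4
      have h5 := Matrix.dotProduct_star_self_pos_iff.2 h3
      exact (pos_iff_pos_of_mul_pos h4).2 h5
  choose B hB hBφ using key
  exact ⟨B, hB, fun x i => by rw [hloc'', ← hφ, hBφ]⟩

end BlockAlgebra

/-! ### Normalisation of the weight, uniqueness, and the δ-form. -/

section CanonicalWeight

variable {A : Type*} [CStarAlgebra A] {ι : Type*} {n : ι → ℕ}

/-- The linear equivalence underlying a `*`-isomorphism with a direct sum of matrix algebras. -/
def blockLinearEquiv (e : A ≃⋆ₐ[ℂ] (∀ i, Matrix (Fin (n i)) (Fin (n i)) ℂ)) :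
    A ≃ₗ[ℂ] (∀ i, Matrix (Fin (n i)) (Fin (n i)) ℂ) where
  toFun := e
  invFun := e.symm
  left_inv := e.symm_apply_apply
  right_inv := e.apply_symm_apply
  map_add' := map_add e
  map_smul' c a := map_smul e c a

theorem IsPos.ringInverse_apply {e : A ≃⋆ₐ[ℂ] (∀ i, Matrix (Fin (n i)) (Fin (n i)) ℂ)} {Q : A}
    (hQ : IsPos e Q) (i : ι) : e (Ring.inverse Q) i = (e Q i)⁻¹ := by
  let u : Aˣ := ⟨Q, e.symm fun i => (e Q i)⁻¹,
    EquivLike.injective e <| by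
      rw [map_mul, e.apply_symm_apply, map_one]
      exact funext fun i => posDef_mul_inv (hQ i),
    EquivLike.injective e <| by
      rw [map_mul, e.apply_symm_apply, map_one]
      exact funext fun i => posDef_inv_mul (hQ i)⟩
  have h : Ring.inverse Q = e.symm fun i => (e Q i)⁻¹ := Ring.inverse_unit u
  rw [h, e.apply_symm_apply]

theorem IsPos.conj_apply {e : A ≃⋆ₐ[ℂ] (∀ i, Matrix (Fin (n i)) (Fin (n i)) ℂ)} {Q : A}
    (hQ : IsPos e Q) (a : A) (i : ι) :
    e (Q * a * Ring.inverse Q) i = e Q i * e a i * (e Q i)⁻¹ := by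
  rw [map_mul, map_mul, Pi.mul_apply, Pi.mul_apply, hQ.ringInverse_apply]

theorem blockTrace_pow [Fintype ι] (e : A ≃⋆ₐ[ℂ] (∀ i, Matrix (Fin (n i)) (Fin (n i)) ℂ)) (Q : A)
    (k : ℕ) : blockTrace e (Q ^ k) = ∑ i, ((e Q i) ^ k).trace := by
  change ∑ i, (e (Q ^ k) i).trace = _
  simp only [map_pow, Pi.pow_apply]

theorem exists_posDef_trace_eq {m : ℕ} [NeZero m] {B : Matrix (Fin m) (Fin m) ℂ}
    (hB : B.PosDef) : ∃ r : ℝ, 0 < r ∧ B.trace = (r : ℂ) := by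
  obtain ⟨h1, h2⟩ := Complex.pos_iff.1 hB.trace_pos
  exact ⟨_, h1, Complex.ext rfl h2.symm⟩

theorem smul_pow_trace {m : ℕ} (c : ℂ) (B : Matrix (Fin m) (Fin m) ℂ) (k : ℕ) :
    ((c • B) ^ k).trace = c ^ k * (B ^ k).trace := by
  rw [smul_pow, Matrix.trace_smul, smul_eq_mul]

theorem inv_smul_posDef {m : ℕ} {c : ℂ} (hc : c ≠ 0) {B : Matrix (Fin m) (Fin m) ℂ}
    (hB : B.PosDef) : (c • B)⁻¹ = c⁻¹ • B⁻¹ := by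
  refine Matrix.inv_eq_right_inv ?_
  rw [Matrix.smul_mul, Matrix.mul_smul, smul_smul, mul_inv_cancel₀ hc, one_smul,
    posDef_mul_inv hB]

/-- Positive definite matrices implementing the same automorphism are proportional. -/
theorem exists_pos_smul_of_conj_eq {m : ℕ} [NeZero m] {B C : Matrix (Fin m) (Fin m) ℂ}
    (hB : B.PosDef) (hC : C.PosDef) (h : ∀ x, B * x * B⁻¹ = C * x * C⁻¹) :
    ∃ c : ℝ, 0 < c ∧ C = (c : ℂ) • B := by
  have hcomm : ∀ x, (B⁻¹ * C) * x = x * (B⁻¹ * C) := fun x => by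
    calc B⁻¹ * C * x = B⁻¹ * (C * x * C⁻¹) * C := by
          simp only [Matrix.mul_assoc]; rw [posDef_inv_mul hC, Matrix.mul_one]
      _ = (B⁻¹ * B) * x * (B⁻¹ * C) := by rw [← h]; simp only [Matrix.mul_assoc]
      _ = _ := by rw [posDef_inv_mul hB, Matrix.one_mul]
  obtain ⟨c, hc⟩ := eq_smul_one_of_commute hcomm
  have hCB : C = c • B := by
    calc C = B * (B⁻¹ * C) := by rw [← Matrix.mul_assoc, posDef_mul_inv hB, Matrix.one_mul]
      _ = _ := by rw [hc, Matrix.mul_smul, Matrix.mul_one]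
  have h1 : 0 < c * B.trace := by
    have := hC.trace_pos
    rwa [hCB, Matrix.trace_smul, smul_eq_mul] at this
  have h2 : 0 < c := (pos_iff_pos_of_mul_pos h1).2 hB.trace_pos
  obtain ⟨h3, h4⟩ := Complex.pos_iff.1 h2
  exact ⟨c.re, h3, by rw [hCB]; congr 1; exact Complex.ext rfl h4.symm⟩

variable [Fintype ι] [∀ i, NeZero (n i)]

/-- Equal traces of inverse fourth powers force sᵢ⁴ to be proportional to βᵢ = Tr(Bᵢ⁻⁴). With αᵢ =
Tr(Bᵢ⁴), total trace 1 forces the factor 1/t, t = ∑ αᵢβᵢ, and t is then the common value. -/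
theorem exists_normalized_weight [Nonempty ι] {B : ∀ i, Matrix (Fin (n i)) (Fin (n i)) ℂ}
    (hB : ∀ i, (B i).PosDef) : ∃ s : ι → ℝ, (∀ i, 0 < s i) ∧
      ∑ i, ((((s i : ℝ) : ℂ) • B i) ^ 4).trace = 1 ∧
      ∀ i j, (((((s i : ℝ) : ℂ) • B i)⁻¹) ^ 4).trace = (((((s j : ℝ) : ℂ) • B j)⁻¹) ^ 4).trace := by
  choose α hα using fun i => exists_posDef_trace_eq (posDef_pow (hB i) 4)
  choose β hβ using fun i => exists_posDef_trace_eq (posDef_pow (hB i).inv 4)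
  set t : ℝ := ∑ i, α i * β i with ht
  have ht0 : 0 < t := Finset.sum_pos (fun i _ => mul_pos (hα i).1 (hβ i).1) Finset.univ_nonempty
  have hs4 : ∀ i, ((β i / t) ^ (1 / 4 : ℝ)) ^ 4 = β i / t := fun i => by
    rw [← Real.rpow_natCast, ← Real.rpow_mul (div_pos (hβ i).1 ht0).le]
    norm_num
  have hs0 : ∀ i, 0 < (β i / t) ^ (1 / 4 : ℝ) := fun i =>
    Real.rpow_pos_of_pos (div_pos (hβ i).1 ht0) _
  refine ⟨fun i => (β i / t) ^ (1 / 4 : ℝ), hs0, ?_, ?_⟩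
  · simp only [smul_pow_trace, ← Complex.ofReal_pow, hs4]
    calc _ = ∑ i, (((β i / t) * α i : ℝ) : ℂ) := Finset.sum_congr rfl fun i _ => by
            rw [(hα i).2, Complex.ofReal_mul]
      _ = (((∑ i, α i * β i) / t : ℝ) : ℂ) := by
            rw [← Complex.ofReal_sum, Finset.sum_div]
            congr 1
            exact Finset.sum_congr rfl fun i _ => by ring
      _ = 1 := by rw [← ht, div_self ht0.ne', Complex.ofReal_one]
  · have h : ∀ i, ((((((β i / t) ^ (1 / 4 : ℝ) : ℝ) : ℂ) • B i)⁻¹) ^ 4).trace = (t : ℂ) := by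
      intro i
      have hb : (β i : ℂ) ≠ 0 := by exact_mod_cast (hβ i).1.ne'
      have htc : (t : ℂ) ≠ 0 := by exact_mod_cast ht0.ne'
      rw [inv_smul_posDef (by exact_mod_cast (hs0 i).ne') (hB i), smul_pow_trace, inv_pow,
        ← Complex.ofReal_pow, hs4, (hβ i).2, Complex.ofReal_div]
      field_simp
    intro i j
    rw [h, h]

variable {H : Type*} [Ring H] [StarRing H] [HopfAlgebra ℂ H] [StarModule ℂ H]

/-- The blocks of two solutions differ by positive scalars cᵢ. Equality of the inverse traces makes
cᵢ⁴ independent of i, and the trace condition makes it 1. -/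
theorem IsCanonicalWeight.unique [Nonempty ι]
    {e : A ≃⋆ₐ[ℂ] (∀ i, Matrix (Fin (n i)) (Fin (n i)) ℂ)} {v : A →⋆ₐ[ℂ] A ⊗[ℂ] H} {Q Q' : A}
    (hQ : IsCanonicalWeight e v Q) (hQ' : IsCanonicalWeight e v Q') : Q = Q' := by
  classical
  have hc : ∀ i, ∃ c : ℝ, 0 < c ∧ e Q' i = (c : ℂ) • e Q i := fun i => by
    refine exists_pos_smul_of_conj_eq (hQ.pos i) (hQ'.pos i) fun x => ?_
    have h := congrArg (fun a => e a i)
      ((hQ.ad_eq (e.symm (Pi.single i x))).trans (hQ'.ad_eq (e.symm (Pi.single i x))).symm)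
    simpa only [hQ.pos.conj_apply, hQ'.pos.conj_apply, e.apply_symm_apply, Pi.single_eq_same]
      using h
  choose c hc0 hc using hc
  have i₀ : ι := Classical.arbitrary ι
  have hcC : ∀ i, (c i : ℂ) ≠ 0 := fun i => by exact_mod_cast (hc0 i).ne'
  have hT : ∀ i, blockInvTrace e Q i ≠ 0 := fun i =>
    (posDef_pow (hQ.pos i).inv 4).trace_pos.ne'
  have hT' : ∀ i, blockInvTrace e Q i = (c i : ℂ) ^ 4 * blockInvTrace e Q' i := fun i => by
    unfold blockInvTrace
    rw [hc i, inv_smul_posDef (hcC i) (hQ.pos i), smul_pow_trace, ← mul_assoc, ← mul_pow,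
      mul_inv_cancel₀ (hcC i), one_pow, one_mul]
  have hconst : ∀ i, (c i : ℂ) ^ 4 = (c i₀ : ℂ) ^ 4 := fun i => by
    have h1 := hT' i
    rw [hQ.blocks_eq i i₀, hQ'.blocks_eq i i₀, hT' i₀] at h1
    refine (mul_right_cancel₀ ?_ h1).symm
    intro h0
    exact hT i₀ (by rw [hT' i₀, h0, mul_zero])
  have h1 : (c i₀ : ℂ) ^ 4 = 1 := by
    have h2 := hQ'.trace_eq
    have h3 := hQ.trace_eq
    rw [blockTrace_pow] at h2 h3
    simp only [hc, smul_pow_trace, hconst] at h2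
    rwa [← Finset.mul_sum, h3, mul_one] at h2
  have h2 : ∀ i, c i = 1 := fun i => by
    have h3 : c i ^ 4 = 1 := by exact_mod_cast (hconst i).trans h1
    exact (pow_eq_one_iff_of_nonneg (hc0 i).le (by norm_num)).1 h3
  refine EquivLike.injective e (funext fun i => ?_)
  rw [hc, h2, Complex.ofReal_one, one_smul]

theorem IsCoaction.exists_canonicalWeight [IsCQGAlgebra H] [Nonempty ι]
    (e : A ≃⋆ₐ[ℂ] (∀ i, Matrix (Fin (n i)) (Fin (n i)) ℂ)) {v : A →⋆ₐ[ℂ] A ⊗[ℂ] H}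
    (hv : IsCoaction v) : ∃ Q : A, IsCanonicalWeight e v Q := by
  have : FiniteDimensional ℂ A := (blockLinearEquiv e).symm.finiteDimensional
  obtain ⟨hstar, d, Φ, R, hR, hΦ⟩ := hv.exists_posDef
  set θ := slice (woronowiczFunctional H (1 / 4)) v with hθ
  let E := blockLinearEquiv e
  have hE : ∀ a, E a = e a := fun _ => rfl
  have hEs : ∀ x, E.symm x = e.symm x := fun _ => rfl
  obtain ⟨B, hB, hBθ⟩ := exists_posDef_conj_pi (E.toLinearMap ∘ₗ θ ∘ₗ E.symm.toLinearMap)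
    (fun a b => by
      simp only [LinearMap.comp_apply, LinearEquiv.coe_coe, hE, hEs, map_mul]
      rw [hθ, slice_mul woronowiczFunctional_quarter_mul, map_mul])
    (fun a => by
      simp only [LinearMap.comp_apply, LinearEquiv.coe_coe, hE, hEs, map_star,
        e.symm_apply_apply, hstar, e.apply_symm_apply])
    (E.symm.trans Φ) hR (fun a => by simp [hΦ])
  obtain ⟨s, hs0, hs1, hs2⟩ := exists_normalized_weight hB
  have hsC : ∀ i, ((s i : ℝ) : ℂ) ≠ 0 := fun i => by exact_mod_cast (hs0 i).ne'
  have hpos : IsPos e (e.symm fun i => ((s i : ℝ) : ℂ) • B i) := fun i => by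
    rw [e.apply_symm_apply]
    exact (hB i).smul (by exact_mod_cast hs0 i)
  refine ⟨e.symm fun i => ((s i : ℝ) : ℂ) • B i, ⟨fun a => ?_, hpos, ?_, fun i j => ?_⟩⟩
  · refine EquivLike.injective e (funext fun i => ?_)
    rw [hpos.conj_apply, e.apply_symm_apply, inv_smul_posDef (hsC i) (hB i), Matrix.mul_smul,
      Matrix.smul_mul, Matrix.smul_mul, smul_smul, inv_mul_cancel₀ (hsC i), one_smul, ← hBθ]
    simp only [LinearMap.comp_apply, LinearEquiv.coe_coe, hE, hEs, e.symm_apply_apply, hθ]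
  · rw [blockTrace_pow, e.apply_symm_apply]
    exact hs1
  · unfold blockInvTrace
    rw [e.apply_symm_apply]
    exact hs2 i j

theorem IsCanonicalWeight.exists_isDeltaForm [Nonempty ι]
    {e : A ≃⋆ₐ[ℂ] (∀ i, Matrix (Fin (n i)) (Fin (n i)) ℂ)} {v : A →⋆ₐ[ℂ] A ⊗[ℂ] H} {Q : A}
    (hQ : IsCanonicalWeight e v Q) : ∃ δ : ℝ, 0 < δ ∧ IsDeltaForm e δ (weightForm e Q) := by
  have i₀ : ι := Classical.arbitrary ι
  obtain ⟨r, h1, h2⟩ := exists_posDef_trace_eq (posDef_pow (hQ.pos i₀).inv 4)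
  -- δ² is the common value of the traces of the inverse fourth powers of the blocks.
  refine ⟨Real.sqrt r, Real.sqrt_pos.2 h1, ?_, Q, hQ.pos, rfl,
    fun i => ?_⟩
  · change blockTrace e (Q ^ 4 * 1) = 1
    rw [mul_one, hQ.trace_eq]
  · rw [hQ.blocks_eq i i₀, ← Complex.ofReal_pow, Real.sq_sqrt h1.le]
    exact h2

end CanonicalWeight

end QuantumCoaction

end

open QuantumCoaction in
/-- `A` is a nonzero finite dimensional C*-algebra, written by means of `e` as a direct sum of
(nonzero) complex matrix algebras. -/
theorem lemma4p1 {H : Type*} [Ring H] [StarRing H] [HopfAlgebra ℂ H] [StarModule ℂ H]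
    [IsCQGAlgebra H] {A : Type*} [CStarAlgebra A] [Nontrivial A]
    {ι : Type*} [Fintype ι] (n : ι → ℕ) [∀ i, NeZero (n i)]
    (e : A ≃⋆ₐ[ℂ] (∀ i, Matrix (Fin (n i)) (Fin (n i)) ℂ))
    (v : A →⋆ₐ[ℂ] A ⊗[ℂ] H) (hv : IsCoaction v) :
    (∃! Q : A, IsCanonicalWeight e v Q) ∧
      ∀ Q : A, IsCanonicalWeight e v Q → ∃ δ : ℝ, 0 < δ ∧ IsDeltaForm e δ (weightForm e Q) := by
  have : Nonempty ι := by
    by_contra h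
    rw [not_nonempty_iff] at h
    exact not_subsingleton A (EquivLike.injective e).subsingleton
  obtain ⟨Q, hQ⟩ := hv.exists_canonicalWeight e
  exact ⟨⟨Q, hQ, fun Q' hQ' => hQ'.unique hQ⟩, fun Q hQ => hQ.exists_isDeltaForm⟩
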